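/- **Setting.** Let $(\Gamma,d)$ be a non-empty countable metric space that is $\nu$-regular with constant $\kappa$, where $\kappa,\nu>0$: every closed ball of radius $n+1$ ($n=0,1,2,\dots$) has at most $\kappa(n+1)^\nu$ points. To each $x\in\Gamma$ attach a finite-dimensional complex Hilbert space $\mathcal H_x$; for finite $\Lambda\subset\Gamma$ put $\mathcal A_\Lambda=\mathcal B(\bigotimes_{x\in\Lambda}\mathcal H_x)$ with the operator norm, and identify $A\in\mathcal A_{Z}$ with $A\otimes\mathbb 1_{\Lambda\setminus Z}\in\mathcal A_\Lambda$ for $Z\subset\Lambda$. A dissipative interaction $\mathscr L=\{L_Z\}$ assigns to every finite $Z\subset\Gamma$ a linear map $L_Z:\mathcal A_Z\to\mathcal A_Z$ in Lindblad form, $L_Z(A)=i[H_Z,A]+\sum_{j=1}^{\ell_Z}\big(K_j^*AK_j-\tfrac12\{K_j^*K_j,A\}\big)$ with $H_Z=H_Z^*$ and $H_Z,K_j\in\mathcal A_Z$. For finite $\Lambda$ let $\mathscr L^\Lambda=\sum_{Z\subset\Lambda}L_Z$ on $\mathcal A_\Lambda$ (each $L_Z$ extended as $L_Z\otimes\mathrm{id}$)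 and $T^\Lambda_t=e^{t\mathscr L^\Lambda}$, $t\ge0$. A non-increasing $F:[0,\infty)\to(0,\infty)$ is an $F$-function if $\|F\|=\sup_x\sum_yF(d(x,y))<\infty$ and $C_F<\infty$, where $C_F$ is the infimum of the constants $C$ with $\sum_zF(d(x,z))F(d(z,y))\le C\,F(d(x,y))$ for all $x,y\in\Gamma$. The $F$-norm $\|\mathscr L\|_F$ is the infimum of the $M$ with $\sum_{Z\ni x,y}\|L_Z\|_{cb}\le M\,F(d(x,y))$ for all $x,y\in\Gamma$, where $\|\Phi\|_{cb}=\sup_n\|\Phi\otimes\mathrm{id}_{M_n}\|$. **Theorem.** Let $\alpha>2\nu+1$ and $F(r)=(1+r)^{-\alpha}$. Let $\|\mathscr L\|_F<\infty$, and set $v=\|\mathscr L\|_FC_F$. Fix $\epsilon\in(0,\alpha-2\nu-1)$, put $\alpha_\epsilon=\alpha-\nu-1-\epsilon$ and $C_\epsilon=\sum_{n\ge0}(1+n)^{-(1+\epsilon)}$, and let $0<\delta<1$ satisfy $(1-\delta)\alpha_\epsilon>\nu$. Then $F$ is an $F$-function on $\Gamma$, the constant $$C=\frac{\kappa C_\epsilon}{C_F}\Big(\kappa\,2^{2\alpha_\epsilon}2^{1-\delta}(C_\epsilon+C_F)+e\,(C_F+\|F\|)\Big)$$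 is positive, and for all finite $X\subset\Lambda\subset\Gamma$, all $A\in\mathcal A_X$, all $r\ge1$ and all $t\ge0$ with $e\,v\,t\le r^\delta$, $$\big\|T^\Lambda_t(A)-T^{X(r)}_t(A)\big\|\le C\,\|A\|\,|X|\,\|\mathscr L\|_F\,\frac{t}{(1+r)^{(1-\delta)\alpha_\epsilon-\nu}} .$$ Here $X(r)$ is the $r$-neighbourhood of $X$ within the volume $\Lambda$, $X(r)=\{y\in\Lambda: d(y,x)\le r\text{ for some }x\in X\}$; when the full $r$-neighbourhood of $X$ in $\Gamma$ is contained in $\Lambda$, this is that full neighbourhood. -/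

import Mathlib

open scoped ENNReal Matrix.Norms.L2Operator

noncomputable section

namespace OpenSpin

/-! ### Geometry and decay functions -/

section Geometry

variable {Γ : Type*} [MetricSpace Γ]

/-- `Γ` is `ν`-regular with constant `κ`: closed balls of radius `n + 1` have at most
`κ (n + 1) ^ ν` points, for every natural number `n`. -/
def IsRegular (Γ : Type*) [MetricSpace Γ] (κ ν : ℝ) : Prop :=
  ∀ (x : Γ) (n : ℕ), (Metric.closedBall x ((n : ℝ) + 1)).Finite ∧
    ((Metric.closedBall x ((n : ℝ) + 1)).ncard : ℝ) ≤ κ * ((n : ℝ) + 1) ^ ν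

/-- The `r`-inflation `X(r)` of a finite set `X`. -/
def inflation (X : Finset Γ) (r : ℝ) : Set Γ := {y | ∃ x ∈ X, dist y x ≤ r}

/-- The part `X(r) ∩ Λ` of the `r`-inflation of `X` lying in the finite volume `Λ`. -/
def inflationIn (Λ X : Finset Γ) (r : ℝ) : Finset Γ :=
  haveI : DecidablePred (fun y => y ∈ inflation X r) := Classical.decPred _
  Λ.filter (fun y => y ∈ inflation X r)

theorem mem_inflationIn {Λ X : Finset Γ} {r : ℝ} {y : Γ} :
    y ∈ inflationIn Λ X r ↔ y ∈ Λ ∧ y ∈ inflation X r := by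
  simp [inflationIn]

theorem inflationIn_subset (Λ X : Finset Γ) (r : ℝ) : inflationIn Λ X r ⊆ Λ :=
  fun _ hy => (mem_inflationIn.1 hy).1

theorem subset_inflationIn {Λ X : Finset Γ} (hX : X ⊆ Λ) {r : ℝ} (hr : 0 ≤ r) :
    X ⊆ inflationIn Λ X r := fun x hx =>
  mem_inflationIn.2 ⟨hX hx, x, hx, by simpa using hr⟩

/-- `‖F‖ = sup_x ∑_y F(d(x,y))`, as an extended non-negative number. -/
def fSum (Γ : Type*) [MetricSpace Γ] (F : ℝ → ℝ) : ℝ≥0∞ :=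
  ⨆ x : Γ, ∑' y : Γ, ENNReal.ofReal (F (dist x y))

/-- The convolution constant `C_F`: the infimum of all `C` with
`∑_z F(d(x,z)) F(d(z,y)) ≤ C F(d(x,y))` for all `x, y`. -/
def convConst (Γ : Type*) [MetricSpace Γ] (F : ℝ → ℝ) : ℝ≥0∞ :=
  sInf {C : ℝ≥0∞ | ∀ x y : Γ,
    ∑' z : Γ, ENNReal.ofReal (F (dist x z)) * ENNReal.ofReal (F (dist z y))
      ≤ C * ENNReal.ofReal (F (dist x y))}

/-- `F` is an `F`-function on `Γ`: it is positive and non-increasing on `[0, ∞)`, uniformly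
summable, and satisfies the convolution condition with some finite constant. -/
structure IsFFunction (Γ : Type*) [MetricSpace Γ] (F : ℝ → ℝ) : Prop where
  pos : ∀ r : ℝ, 0 ≤ r → 0 < F r
  antitone : AntitoneOn F (Set.Ici 0)
  summable : fSum Γ F ≠ ∞
  convolution : convConst Γ F ≠ ∞

/-- The power law `F(r) = (1 + r) ^ (-α)`. -/
def powerLaw (α : ℝ) (r : ℝ) : ℝ := 1 / (1 + r) ^ α

end Geometry

/-! ### Local algebras

The Hilbert space at the site `x` has an orthonormal basis indexed by the finite type `ι x`.
Hence `ℋ_Λ = ⨂_{x ∈ Λ} ℋ_x` has the product orthonormal basis indexed by `Conf ι Λ`, and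
`𝒜_Λ = B(ℋ_Λ)` is the algebra of complex matrices over `Conf ι Λ` with the operator norm
coming from the Euclidean (`ℓ²`) norm. -/

section Algebra

variable {Γ : Type*} [DecidableEq Γ] (ι : Γ → Type*)
  [∀ x, Fintype (ι x)] [∀ x, DecidableEq (ι x)]

/-- Basis labels of `ℋ_Λ`. -/
abbrev Conf (Λ : Finset Γ) := (x : {x : Γ // x ∈ Λ}) → ι x

/-- The algebra `𝒜_Λ` of observables in the finite volume `Λ`. -/
abbrev Obs (Λ : Finset Γ) := Matrix (Conf ι Λ) (Conf ι Λ) ℂ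

variable {ι}

/-- Restriction of a label of `Λ` to `Z ⊆ Λ`. -/
def Conf.restrict {Z Λ : Finset Γ} (h : Z ⊆ Λ) (σ : Conf ι Λ) : Conf ι Z :=
  fun x => σ ⟨x, h x.2⟩

/-- The label of `Λ` that agrees with `a` on `Z` and with `σ` off `Z`. -/
def Conf.glue {Z Λ : Finset Γ} (a : Conf ι Z) (σ : Conf ι Λ) : Conf ι Λ :=
  fun x => if hx : (x : Γ) ∈ Z then a ⟨x, hx⟩ else σ x

/-- The identification `𝒜_Z ∋ A ↦ A ⊗ 𝟙_{Λ ∖ Z} ∈ 𝒜_Λ`. -/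
def embed {Z Λ : Finset Γ} (h : Z ⊆ Λ) (A : Obs ι Z) : Obs ι Λ :=
  Matrix.of fun σ τ =>
    if ∀ x : {x : Γ // x ∈ Λ}, (x : Γ) ∉ Z → σ x = τ x then A (σ.restrict h) (τ.restrict h) else 0

/-- The extension `Φ ⊗ id_{Λ ∖ Z}` to `𝒜_Λ` of a linear map `Φ` on `𝒜_Z`: the map `Φ` is applied
to each block of the matrix `M`, the blocks being labelled by the pairs of labels off `Z`. -/
def extend {Z Λ : Finset Γ} (h : Z ⊆ Λ) (Φ : Obs ι Z →ₗ[ℂ] Obs ι Z) : Obs ι Λ →ₗ[ℂ] Obs ι Λ where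
  toFun M := Matrix.of fun σ τ =>
    Φ (Matrix.of fun a b => M (a.glue σ) (b.glue τ)) (σ.restrict h) (τ.restrict h)
  map_add' M N := by
    ext σ τ
    exact congrFun (congrFun (Φ.map_add
      (Matrix.of fun a b : Conf ι Z => M (a.glue σ) (b.glue τ))
      (Matrix.of fun a b : Conf ι Z => N (a.glue σ) (b.glue τ))) _) _
  map_smul' c M := by
    ext σ τ
    exact congrFun (congrFun (Φ.map_smul c
      (Matrix.of fun a b : Conf ι Z => M (a.glue σ) (b.glue τ))) _) _

end Algebra

/-! ### The completely bounded norm -/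

section CB

variable {m : Type*} [Fintype m] [DecidableEq m]

/-- The block-wise action `Φ ⊗ 𝟙_{n × n}` on `n × n` block matrices; the `(k, l)` block of the
matrix `M` has the entries `M (i, k) (j, l)`. -/
def amplify (Φ : Matrix m m ℂ →ₗ[ℂ] Matrix m m ℂ) (n : ℕ) :
    Matrix (m × Fin n) (m × Fin n) ℂ →ₗ[ℂ] Matrix (m × Fin n) (m × Fin n) ℂ where
  toFun M := Matrix.of fun p q => Φ (Matrix.of fun i j => M (i, p.2) (j, q.2)) p.1 q.1
  map_add' M N := by
    ext p q
    exact congrFun (congrFun (Φ.map_add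
      (Matrix.of fun i j : m => M (i, p.2) (j, q.2))
      (Matrix.of fun i j : m => N (i, p.2) (j, q.2))) _) _
  map_smul' c M := by
    ext p q
    exact congrFun (congrFun (Φ.map_smul c
      (Matrix.of fun i j : m => M (i, p.2) (j, q.2))) _) _

/-- `‖Φ‖_cb = sup_n ‖Φ ⊗ 𝟙_{n × n}‖`, as an extended non-negative number. -/
def cbNorm (Φ : Matrix m m ℂ →ₗ[ℂ] Matrix m m ℂ) : ℝ≥0∞ :=
  ⨆ n : ℕ, ‖LinearMap.toContinuousLinearMap (amplify Φ n)‖ₑ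

/-- `Φ` is in Lindblad form:
`Φ(A) = i[H, A] + ∑_j (K_j* A K_j - ½ {K_j* K_j, A})` with `H = H*` and finitely many `K_j`. -/
def IsLindblad (Φ : Matrix m m ℂ →ₗ[ℂ] Matrix m m ℂ) : Prop :=
  ∃ (H : Matrix m m ℂ) (ℓ : ℕ) (K : Fin ℓ → Matrix m m ℂ), star H = H ∧
    ∀ A : Matrix m m ℂ, Φ A = Complex.I • (H * A - A * H) +
      ∑ j, (star (K j) * A * K j -
        (1 / 2 : ℂ) • (star (K j) * K j * A + A * (star (K j) * K j)))

end CB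

/-! ### Dissipative interactions and their finite-volume dynamics -/

section Dynamics

variable {Γ : Type*} [DecidableEq Γ] (ι : Γ → Type*)
  [∀ x, Fintype (ι x)] [∀ x, DecidableEq (ι x)]

/-- A dissipative interaction: a family of maps `L_Z : 𝒜_Z → 𝒜_Z` in Lindblad form, indexed by the
finite subsets `Z` of `Γ`. -/
structure Interaction where
  term : (Z : Finset Γ) → (Obs ι Z →ₗ[ℂ] Obs ι Z)
  lindblad : ∀ Z, IsLindblad (term Z)

variable {ι}

/-- The `F`-norm `‖𝓛‖_F`: the infimum of all `M` such that
`∑_{Z ∋ x, y} ‖L_Z‖_cb ≤ M F(d(x,y))` for all `x, y`. -/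
def Interaction.fNorm [MetricSpace Γ] (L : Interaction ι) (F : ℝ → ℝ) : ℝ≥0∞ :=
  sInf {M : ℝ≥0∞ | ∀ x y : Γ,
    ∑' Z : {Z : Finset Γ // x ∈ Z ∧ y ∈ Z}, cbNorm (L.term Z.1)
      ≤ M * ENNReal.ofReal (F (dist x y))}

/-- The finite-volume generator `𝓛^Λ = ∑_{Z ⊆ Λ} L_Z` on `𝒜_Λ`. -/
def Interaction.generator (L : Interaction ι) (Λ : Finset Γ) : Obs ι Λ →L[ℂ] Obs ι Λ :=
  LinearMap.toContinuousLinearMap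
    (∑ Z ∈ Λ.powerset.attach, extend (Finset.mem_powerset.1 Z.2) (L.term Z.1))

/-- The finite-volume dynamics `T_t^Λ = exp(t 𝓛^Λ)` on `𝒜_Λ`. -/
def Interaction.dynamics (L : Interaction ι) (Λ : Finset Γ) (t : ℝ) : Obs ι Λ →L[ℂ] Obs ι Λ :=
  NormedSpace.exp ((t : ℂ) • L.generator Λ)

end Dynamics

/-! ### The constants of the estimate -/

/-- `C_ε = ∑_{n ≥ 0} (1 + n) ^ (-(1 + ε))`. -/
def zetaConst (ε : ℝ) : ℝ := ∑' n : ℕ, 1 / (1 + (n : ℝ)) ^ (1 + ε)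

/-- The constant
`κ C_ε / C_F * (κ 2^(2 α_ε) 2^(1-δ) (C_ε + C_F) + e (C_F + ‖F‖))`
for `F(r) = (1 + r) ^ (-α)` and `α_ε = α - ν - 1 - ε`. -/
def localizationConst (Γ : Type*) [MetricSpace Γ] (κ ν α ε δ : ℝ) : ℝ :=
  κ * zetaConst ε / (convConst Γ (powerLaw α)).toReal *
    (κ * 2 ^ (2 * (α - ν - 1 - ε)) * 2 ^ (1 - δ) *
        (zetaConst ε + (convConst Γ (powerLaw α)).toReal) +
      Real.exp 1 * ((convConst Γ (powerLaw α)).toReal + (fSum Γ (powerLaw α)).toReal))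

end OpenSpin

end

/-!
The interaction is split at the range `r ^ (1 - δ)`. A Lindblad generator is dissipative, because
the norm of a matrix is attained at some vector, where the Lindblad form can be evaluated; hence
all finite-volume evolutions are contractions, and Duhamel's formula compares two of them in terms
of the interaction terms by which their generators differ.

Iterating Duhamel's formula bounds the influence of a distant term by a sum over chains of sets
starting at `X`, and by the convolution property of `F` a chain of `k` sets costs
`(v t) ^ k / k !`. Short sets need more than `r ^ δ` steps to cross the distance `r`, so for
`e v t ≤ r ^ δ` their contribution is a factorial tail, and one power of `F` survives to be summed
outside the ball. Long sets need no propagation estimate: their total strength is a tail of `F` at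
distance `r ^ (1 - δ)`. Regularity of `Γ` sums these tails shell by shell.
-/

namespace OpenSpin

section LocalAlgebra

variable {Γ : Type*} {ι : Γ → Type*} {Z Y X Λ : Finset Γ}

namespace Conf

/-- The labels `σ` and `τ` agree at all sites off `Z`. -/
abbrev AgreeOff (Z : Finset Γ) (σ τ : Conf ι Λ) : Prop :=
  ∀ x : {x : Γ // x ∈ Λ}, (x : Γ) ∉ Z → σ x = τ x

theorem agreeOff_comm {σ τ : Conf ι Λ} : AgreeOff Z σ τ ↔ AgreeOff Z τ σ :=
  forall₂_congr fun _ _ => eq_comm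

variable [DecidableEq Γ]

theorem glue_of_mem (a : Conf ι Z) (σ : Conf ι Λ) {x : {x : Γ // x ∈ Λ}} (hx : (x : Γ) ∈ Z) :
    a.glue σ x = a ⟨x, hx⟩ :=
  dif_pos hx

theorem glue_of_notMem (a : Conf ι Z) (σ : Conf ι Λ) {x : {x : Γ // x ∈ Λ}}
    (hx : (x : Γ) ∉ Z) : a.glue σ x = σ x :=
  dif_neg hx

@[simp]
theorem glue_restrict (h : Z ⊆ Λ) (σ : Conf ι Λ) : (σ.restrict h).glue σ = σ := by
  ext x
  by_cases hx : (x : Γ) ∈ Z <;> simp [glue, restrict, hx]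

@[simp]
theorem restrict_glue (h : Z ⊆ Λ) (a : Conf ι Z) (σ : Conf ι Λ) : (a.glue σ).restrict h = a := by
  ext x
  exact glue_of_mem a σ x.2

@[simp]
theorem glue_glue (a b : Conf ι Z) (σ : Conf ι Λ) : a.glue (b.glue σ) = a.glue σ := by
  ext x
  by_cases hx : (x : Γ) ∈ Z <;> simp [glue, hx]

theorem glue_comm_of_disjoint (hd : Disjoint Z Y) (a : Conf ι Z) (b : Conf ι Y)
    (σ : Conf ι Λ) : a.glue (b.glue σ) = b.glue (a.glue σ) := by
  ext x
  by_cases hx : (x : Γ) ∈ Z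
  · simp [glue, hx, Finset.disjoint_left.1 hd hx]
  · simp [glue, hx]

theorem restrict_glue_of_disjoint (hY : Y ⊆ Λ) (hd : Disjoint Z Y) (a : Conf ι Z)
    (σ : Conf ι Λ) : (a.glue σ).restrict hY = σ.restrict hY := by
  ext x
  exact glue_of_notMem a σ (Finset.disjoint_right.1 hd x.2)

theorem glue_injective (h : Z ⊆ Λ) (σ : Conf ι Λ) :
    Function.Injective fun a : Conf ι Z => a.glue σ :=
  Function.LeftInverse.injective (g := restrict h) fun a => restrict_glue h a σ

theorem agreeOff_glue_left (h : Z ⊆ Y) (a : Conf ι Z) {σ τ : Conf ι Λ} :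
    AgreeOff Y (a.glue σ) τ ↔ AgreeOff Y σ τ :=
  forall₂_congr fun _ hx => by rw [glue_of_notMem a σ fun hZ => hx (h hZ)]

theorem agreeOff_glue_glue (h : Z ⊆ Y) (a b : Conf ι Z) {σ τ : Conf ι Λ} :
    AgreeOff Y (a.glue σ) (b.glue τ) ↔ AgreeOff Y σ τ := by
  rw [agreeOff_glue_left h, agreeOff_comm, agreeOff_glue_left h, agreeOff_comm]

theorem AgreeOff.glue_restrict {σ τ : Conf ι Λ} (hστ : AgreeOff Z σ τ) (h : Z ⊆ Λ) :
    (τ.restrict h).glue σ = τ := by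
  ext x
  by_cases hx : (x : Γ) ∈ Z
  · exact glue_of_mem _ _ hx
  · exact (glue_of_notMem _ _ hx).trans (hστ x hx)

theorem agreeOff_glue_glue_of_disjoint (hZ : Z ⊆ Λ) (hd : Disjoint Z Y) (a b : Conf ι Z)
    {σ τ : Conf ι Λ} :
    AgreeOff Y (a.glue σ) (b.glue τ) ↔ a = b ∧ AgreeOff (Z ∪ Y) σ τ := by
  constructor
  · refine fun h => ⟨funext fun x => ?_, fun x hx => ?_⟩
    · have hx := h ⟨x, hZ x.2⟩ (Finset.disjoint_left.1 hd x.2)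
      rwa [glue_of_mem a σ x.2, glue_of_mem b τ x.2] at hx
    · have hx' : (x : Γ) ∉ Z ∧ (x : Γ) ∉ Y := by simpa using hx
      simpa [glue, hx'.1] using h x hx'.2
  · rintro ⟨rfl, h⟩ x hx
    by_cases hxZ : (x : Γ) ∈ Z
    · rw [glue_of_mem a σ hxZ, glue_of_mem a τ hxZ]
    · rw [glue_of_notMem a σ hxZ, glue_of_notMem a τ hxZ]
      exact h x (by simp [hxZ, hx])

end Conf

variable [DecidableEq Γ]

/-- The block of `M ∈ 𝒜_Λ` labelled by the restrictions of `σ` and `τ` to `Λ ∖ Z`. In terms of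
blocks, `extend h Φ` is `Φ` applied to each block, and products with `embed h B` are blockwise. -/
def block (Z : Finset Γ) (σ τ : Conf ι Λ) : Obs ι Λ →ₗ[ℂ] Obs ι Z where
  toFun M := Matrix.of fun a b => M (a.glue σ) (b.glue τ)
  map_add' _ _ := rfl
  map_smul' _ _ := rfl

theorem block_apply (σ τ : Conf ι Λ) (M : Obs ι Λ) (a b : Conf ι Z) :
    block Z σ τ M a b = M (a.glue σ) (b.glue τ) :=
  rfl

theorem ext_block (h : Z ⊆ Λ) {M N : Obs ι Λ} (hMN : ∀ σ τ, block Z σ τ M = block Z σ τ N) :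
    M = N := by
  ext σ τ
  simpa [block_apply] using congrFun₂ (hMN σ τ) (σ.restrict h) (τ.restrict h)

theorem block_star (σ τ : Conf ι Λ) (M : Obs ι Λ) :
    block Z σ τ (star M) = star (block Z τ σ M) :=
  rfl

theorem extend_apply (h : Z ⊆ Λ) (Φ : Obs ι Z →ₗ[ℂ] Obs ι Z) (M : Obs ι Λ) (σ τ : Conf ι Λ) :
    extend h Φ M σ τ = Φ (block Z σ τ M) (σ.restrict h) (τ.restrict h) :=
  rfl

theorem block_extend (h : Z ⊆ Λ) (Φ : Obs ι Z →ₗ[ℂ] Obs ι Z) (M : Obs ι Λ) (σ τ : Conf ι Λ) :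
    block Z σ τ (extend h Φ M) = Φ (block Z σ τ M) := by
  ext a b
  have hblock : block Z (a.glue σ) (b.glue τ) M = block Z σ τ M := by
    ext c d
    simp only [block_apply, Conf.glue_glue]
  rw [block_apply, extend_apply, hblock, Conf.restrict_glue, Conf.restrict_glue]

theorem linearMap_apply_eq_sum_single {R m n : Type*} [CommSemiring R] [Fintype m]
    [DecidableEq m] [Fintype n] [DecidableEq n] (φ : Matrix m n R →ₗ[R] R) (M : Matrix m n R) :
    φ M = ∑ a, ∑ b, M a b * φ (Matrix.single a b 1) := by
  conv_lhs => rw [Matrix.matrix_eq_sum_single M]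
  simp only [map_sum]
  refine Finset.sum_congr rfl fun a _ => Finset.sum_congr rfl fun b _ => ?_
  rw [← smul_eq_mul, ← map_smul, Matrix.smul_single, smul_eq_mul, mul_one]

theorem linearMap_apply_comm {R m n p q : Type*} [CommSemiring R] [Finite m] [Finite n]
    (φ : Matrix m n R →ₗ[R] R) (ψ : Matrix p q R →ₗ[R] R) (M : m → n → Matrix p q R) :
    φ (Matrix.of fun a b => ψ (M a b)) =
      ψ (Matrix.of fun c d => φ (Matrix.of fun a b => M a b c d)) := by
  classical
  cases nonempty_fintype m
  cases nonempty_fintype n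
  rw [linearMap_apply_eq_sum_single φ]
  have hψ : (Matrix.of fun c d => φ (Matrix.of fun a b => M a b c d)) =
      ∑ a, ∑ b, φ (Matrix.single a b 1) • M a b := by
    ext c d
    rw [Matrix.of_apply, linearMap_apply_eq_sum_single φ]
    simp [Matrix.sum_apply, mul_comm]
  simp [hψ, mul_comm]

theorem extend_comm_of_disjoint [∀ x, Finite (ι x)] (hZ : Z ⊆ Λ) (hY : Y ⊆ Λ)
    (hd : Disjoint Z Y) (Φ : Obs ι Z →ₗ[ℂ] Obs ι Z) (Ψ : Obs ι Y →ₗ[ℂ] Obs ι Y)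
    (M : Obs ι Λ) : extend hZ Φ (extend hY Ψ M) = extend hY Ψ (extend hZ Φ M) := by
  ext σ τ
  have hΨΦ : block Z σ τ (extend hY Ψ M) = Matrix.of fun a b =>
      Ψ (block Y (a.glue σ) (b.glue τ) M) (σ.restrict hY) (τ.restrict hY) := by
    ext a b
    simp only [block_apply, extend_apply, Conf.restrict_glue_of_disjoint hY hd, Matrix.of_apply]
  have hΦΨ : block Y σ τ (extend hZ Φ M) = Matrix.of fun c d =>
      Φ (Matrix.of fun a b => block Y (a.glue σ) (b.glue τ) M c d)
        (σ.restrict hZ) (τ.restrict hZ) := by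
    ext c d
    simp only [block_apply, extend_apply, Conf.restrict_glue_of_disjoint hZ hd.symm,
      Matrix.of_apply, ← Conf.glue_comm_of_disjoint hd]
    rfl
  rw [extend_apply, extend_apply, hΨΦ, hΦΨ]
  exact linearMap_apply_comm
    (Matrix.entryLinearMap ℂ ℂ (σ.restrict hZ) (τ.restrict hZ) ∘ₗ Φ)
    (Matrix.entryLinearMap ℂ ℂ (σ.restrict hY) (τ.restrict hY) ∘ₗ Ψ)
    fun a b => block Y (a.glue σ) (b.glue τ) M

variable [∀ x, DecidableEq (ι x)]

theorem block_embed (h : Z ⊆ Λ) (A : Obs ι Z) (σ τ : Conf ι Λ) :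
    block Z σ τ (embed h A) = if σ.AgreeOff Z τ then A else 0 := by
  ext a b
  simp only [block_apply, embed, Matrix.of_apply, Conf.restrict_glue,
    Conf.agreeOff_glue_glue subset_rfl]
  split_ifs <;> rfl

theorem block_embed_of_subset (h : Z ⊆ Y) (hY : Y ⊆ Λ) (A : Obs ι Y) (σ τ : Conf ι Λ) :
    block Z σ τ (embed hY A) =
      if σ.AgreeOff Y τ then block Z (σ.restrict hY) (τ.restrict hY) A else 0 := by
  ext a b
  simp only [block_apply, embed, Matrix.of_apply, Conf.agreeOff_glue_glue h]
  split_ifs <;> rfl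

theorem exists_block_embed_eq_smul_one (hZ : Z ⊆ Λ) (hY : Y ⊆ Λ) (hd : Disjoint Z Y)
    (B : Obs ι Y) (σ τ : Conf ι Λ) : ∃ c : ℂ, block Z σ τ (embed hY B) = c • 1 := by
  refine ⟨if σ.AgreeOff (Z ∪ Y) τ then B (σ.restrict hY) (τ.restrict hY) else 0, ?_⟩
  ext a b
  simp only [block_apply, embed, Matrix.of_apply, Conf.agreeOff_glue_glue_of_disjoint hZ hd,
    Conf.restrict_glue_of_disjoint hY hd, Matrix.smul_apply, Matrix.one_apply, ite_and]
  split_ifs <;> simp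

theorem embed_add (h : Z ⊆ Λ) (A B : Obs ι Z) : embed h (A + B) = embed h A + embed h B := by
  refine ext_block h fun σ τ => ?_
  rw [map_add, block_embed, block_embed, block_embed]
  split_ifs <;> simp

theorem embed_smul (h : Z ⊆ Λ) (c : ℂ) (A : Obs ι Z) : embed h (c • A) = c • embed h A := by
  refine ext_block h fun σ τ => ?_
  rw [map_smul, block_embed, block_embed, smul_ite, smul_zero]

theorem embed_star (h : Z ⊆ Λ) (A : Obs ι Z) : embed h (star A) = star (embed h A) := by
  refine ext_block h fun σ τ => ?_
  rw [block_star, block_embed, block_embed, apply_ite star, star_zero]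
  exact if_congr Conf.agreeOff_comm rfl rfl

theorem embed_refl (A : Obs ι Λ) : embed subset_rfl A = A := by
  ext σ τ
  exact if_pos fun x hx => absurd x.2 hx

theorem embed_embed (h : Z ⊆ Y) (hY : Y ⊆ Λ) (A : Obs ι Z) :
    embed hY (embed h A) = embed (h.trans hY) A := by
  refine ext_block (h.trans hY) fun σ τ => ?_
  rw [block_embed_of_subset h, block_embed, block_embed, ← ite_and]
  refine if_congr ⟨fun ⟨hoffY, hoff⟩ x hx => ?_,
    fun hoff => ⟨fun x hx => hoff x fun hZ => hx (h hZ), fun x hx => hoff ⟨x, hY x.2⟩ hx⟩⟩ rfl rfl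
  by_cases hxY : (x : Γ) ∈ Y
  · exact hoff ⟨x, hxY⟩ hx
  · exact hoffY x hxY

theorem embed_extend (h : Z ⊆ Y) (hY : Y ⊆ Λ) (Φ : Obs ι Z →ₗ[ℂ] Obs ι Z) (A : Obs ι Y) :
    embed hY (extend h Φ A) = extend (h.trans hY) Φ (embed hY A) := by
  refine ext_block (h.trans hY) fun σ τ => ?_
  rw [block_extend, block_embed_of_subset h, block_embed_of_subset h, block_extend, apply_ite Φ,
    map_zero]

theorem extend_embed_of_disjoint (hZ : Z ⊆ Λ) (hX : X ⊆ Λ) (hd : Disjoint Z X)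
    {Φ : Obs ι Z →ₗ[ℂ] Obs ι Z} (hΦ : Φ 1 = 0) (A : Obs ι X) :
    extend hZ Φ (embed hX A) = 0 := by
  refine ext_block hZ fun σ τ => ?_
  obtain ⟨c, hc⟩ := exists_block_embed_eq_smul_one hZ hX hd A σ τ
  rw [block_extend, hc, map_smul, hΦ, smul_zero, map_zero]

variable [∀ x, Fintype (ι x)]

theorem block_embed_mul (h : Z ⊆ Λ) (B : Obs ι Z) (M : Obs ι Λ) (σ τ : Conf ι Λ) :
    block Z σ τ (embed h B * M) = B * block Z σ τ M := by
  ext a b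
  rw [block_apply, Matrix.mul_apply, Matrix.mul_apply]
  symm
  refine Fintype.sum_of_injective _ (Conf.glue_injective h σ) _ _ (fun ρ hρ => ?_) fun c => ?_
  · have hoff : ¬ (a.glue σ).AgreeOff Z ρ := fun hoff =>
      hρ ⟨ρ.restrict h, ((Conf.agreeOff_glue_left subset_rfl a).1 hoff).glue_restrict h⟩
    rw [embed, Matrix.of_apply, if_neg hoff, zero_mul]
  · have hon : (a.glue σ).AgreeOff Z (c.glue σ) :=
      (Conf.agreeOff_glue_glue subset_rfl a c).2 fun _ _ => rfl
    rw [embed, Matrix.of_apply, if_pos hon, Conf.restrict_glue, Conf.restrict_glue, block_apply]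

theorem block_mul_embed (h : Z ⊆ Λ) (M : Obs ι Λ) (B : Obs ι Z) (σ τ : Conf ι Λ) :
    block Z σ τ (M * embed h B) = block Z σ τ M * B := by
  rw [← star_star (M * embed h B), star_mul, ← embed_star, block_star, block_embed_mul, star_mul,
    star_star, block_star, star_star]

theorem embed_mul (h : Z ⊆ Λ) (A B : Obs ι Z) : embed h (A * B) = embed h A * embed h B := by
  refine ext_block h fun σ τ => ?_
  rw [block_embed_mul, block_embed, block_embed, mul_ite, mul_zero]

/-- The identification `𝒜_Z → 𝒜_Λ` as a homomorphism of star algebras. -/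
def embedHom (h : Z ⊆ Λ) : Obs ι Z →⋆ₙₐ[ℂ] Obs ι Λ where
  toFun := embed h
  map_smul' := embed_smul h
  map_zero' := by simpa using embed_smul h 0 (0 : Obs ι Z)
  map_add' := embed_add h
  map_mul' := embed_mul h
  map_star' := embed_star h

theorem norm_embed_le (h : Z ⊆ Λ) (A : Obs ι Z) : ‖embed h A‖ ≤ ‖A‖ :=
  NonUnitalStarAlgHom.norm_apply_le (embedHom h) A

end LocalAlgebra

section ExtensionNorm

theorem norm_reindex {m n : Type*} [Fintype m] [DecidableEq m] [Fintype n] [DecidableEq n]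
    (e : m ≃ n) (A : Matrix m m ℂ) : ‖Matrix.reindex e e A‖ = ‖A‖ :=
  StarAlgEquiv.norm_map
    (StarAlgEquiv.ofAlgEquiv (Matrix.reindexAlgEquiv ℂ ℂ e) fun _ => rfl) A

variable {Γ : Type*} [DecidableEq Γ] {ι : Γ → Type*} {Z Λ : Finset Γ}

/-- A label of `Λ` is a label of `Z ⊆ Λ` together with a label of `Λ ∖ Z`; this is the
factorization `ℋ_Λ = ℋ_Z ⊗ ℋ_{Λ ∖ Z}` at the level of basis labels. -/
def confEquiv (h : Z ⊆ Λ) :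
    Conf ι Λ ≃ Conf ι Z × ((x : {x : {x : Γ // x ∈ Λ} // (x : Γ) ∉ Z}) → ι x) where
  toFun σ := (σ.restrict h, fun x => σ x)
  invFun p x := if hx : (x : Γ) ∈ Z then p.1 ⟨x, hx⟩ else p.2 ⟨x, hx⟩
  left_inv σ := by
    ext x
    by_cases hx : (x : Γ) ∈ Z <;> simp [Conf.restrict, hx]
  right_inv p := by
    ext x
    · simp [Conf.restrict]
    · simp [x.2]

theorem exists_reindex_extend_eq_amplify [∀ x, Finite (ι x)] (h : Z ⊆ Λ)
    (Φ : Obs ι Z →ₗ[ℂ] Obs ι Z) :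
    ∃ (n : ℕ) (e : Conf ι Λ ≃ Conf ι Z × Fin n), ∀ M : Obs ι Λ,
      Matrix.reindex e e (extend h Φ M) = amplify Φ n (Matrix.reindex e e M) := by
  let e := (confEquiv (ι := ι) h).trans (Equiv.prodCongr (Equiv.refl _) (Finite.equivFin _))
  have he_symm (a : Conf ι Z) (σ : Conf ι Λ) : e.symm (a, (e σ).2) = a.glue σ :=
    congrArg (fun q => (confEquiv h).symm (a, q)) ((Finite.equivFin _).symm_apply_apply _)
  refine ⟨_, e, fun M => ?_⟩
  ext p q
  obtain ⟨σ, rfl⟩ := e.surjective p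
  obtain ⟨τ, rfl⟩ := e.surjective q
  rw [Matrix.reindex_apply, Matrix.submatrix_apply, e.symm_apply_apply, e.symm_apply_apply]
  have hblock : block Z σ τ M =
      Matrix.of fun a b => Matrix.reindex e e M (a, (e σ).2) (b, (e τ).2) := by
    ext a b
    simp [block_apply, he_symm]
  rw [extend_apply, hblock]
  rfl

variable [∀ x, Fintype (ι x)] [∀ x, DecidableEq (ι x)]

theorem norm_extend_le (h : Z ⊆ Λ) {Φ : Obs ι Z →ₗ[ℂ] Obs ι Z} (hΦ : cbNorm Φ ≠ ∞)
    (M : Obs ι Λ) : ‖extend h Φ M‖ ≤ (cbNorm Φ).toReal * ‖M‖ := by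
  obtain ⟨n, e, he⟩ := exists_reindex_extend_eq_amplify h Φ
  have hn : ‖LinearMap.toContinuousLinearMap (amplify Φ n)‖ ≤ (cbNorm Φ).toReal := by
    rw [← toReal_enorm]
    exact ENNReal.toReal_mono hΦ
      (le_iSup (fun n => ‖LinearMap.toContinuousLinearMap (amplify Φ n)‖ₑ) n)
  rw [← norm_reindex e, he, ← norm_reindex e M]
  exact ContinuousLinearMap.le_of_opNorm_le _ hn _

end ExtensionNorm

section LindbladForm

variable {m : Type*} [Fintype m] {Φ Ψ : Matrix m m ℂ →ₗ[ℂ] Matrix m m ℂ}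

theorem isLindblad_zero : IsLindblad (0 : Matrix m m ℂ →ₗ[ℂ] Matrix m m ℂ) :=
  ⟨0, 0, fun _ => 0, by simp, by simp⟩

theorem IsLindblad.add (hΦ : IsLindblad Φ) (hΨ : IsLindblad Ψ) : IsLindblad (Φ + Ψ) := by
  obtain ⟨H, ℓ, K, hH, hK⟩ := hΦ
  obtain ⟨H', ℓ', K', hH', hK'⟩ := hΨ
  refine ⟨H + H', ℓ + ℓ', Fin.append K K', by rw [star_add, hH, hH'], fun A => ?_⟩
  simp only [LinearMap.add_apply, hK, hK', Fin.sum_univ_add, Fin.append_left, Fin.append_right,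
    add_mul, mul_add, smul_sub, smul_add]
  abel

theorem isLindblad_sum {κ : Type*} (S : Finset κ) {Φ : κ → Matrix m m ℂ →ₗ[ℂ] Matrix m m ℂ}
    (hΦ : ∀ k ∈ S, IsLindblad (Φ k)) : IsLindblad (∑ k ∈ S, Φ k) :=
  Finset.sum_induction Φ IsLindblad (fun _ _ => IsLindblad.add) isLindblad_zero hΦ

theorem IsLindblad.map_one [DecidableEq m] (hΦ : IsLindblad Φ) : Φ 1 = 0 := by
  obtain ⟨H, ℓ, K, -, hK⟩ := hΦ
  simp [hK, ← two_smul ℂ, smul_smul]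

theorem IsLindblad.extend {Γ : Type*} [DecidableEq Γ] {ι : Γ → Type*} [∀ x, Fintype (ι x)]
    {Z Λ : Finset Γ} (h : Z ⊆ Λ) {Φ : Obs ι Z →ₗ[ℂ] Obs ι Z} (hΦ : IsLindblad Φ) :
    IsLindblad (extend h Φ) := by
  classical
  obtain ⟨H, ℓ, K, hH, hK⟩ := hΦ
  refine ⟨embed h H, ℓ, fun j => embed h (K j), by rw [← embed_star, hH], fun A => ?_⟩
  refine ext_block h fun σ τ => ?_
  rw [block_extend, hK]
  simp only [← embed_star, ← embed_mul, map_add, map_sub, map_smul, map_sum, block_embed_mul,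
    block_mul_embed]

end LindbladForm

section NormAttainingVectors

variable {𝕜 V W : Type*} [RCLike 𝕜]

theorem exists_norm_eq_opNorm [NormedAddCommGroup V] [NormedSpace 𝕜 V] [FiniteDimensional 𝕜 V]
    [Nontrivial V] [SeminormedAddCommGroup W] [NormedSpace 𝕜 W] (T : V →L[𝕜] W) :
    ∃ ψ : V, ‖ψ‖ = 1 ∧ ‖T ψ‖ = ‖T‖ := by
  let _ : NormedSpace ℝ V := NormedSpace.restrictScalars ℝ 𝕜 V
  have := FiniteDimensional.proper 𝕜 V
  obtain ⟨ψ, hψ, hmax⟩ := (isCompact_sphere (0 : V) 1).exists_isMaxOn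
    (NormedSpace.sphere_nonempty.2 zero_le_one) T.continuous.norm.continuousOn
  have hψ1 : ‖ψ‖ = 1 := by simpa using hψ
  refine ⟨ψ, hψ1, le_antisymm (T.unit_le_opNorm ψ hψ1.le) ?_⟩
  exact T.opNorm_le_of_unit_norm (norm_nonneg _) fun x hx => hmax (by simpa using hx)

variable [NormedAddCommGroup V] [InnerProductSpace 𝕜 V] [NormedAddCommGroup W]
  [InnerProductSpace 𝕜 W]

theorem norm_le_norm_sub_smul_of_re_inner_nonpos {A B : V →L[𝕜] W} {ψ : V} (hψ : ‖ψ‖ = 1)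
    (hA : ‖A ψ‖ = ‖A‖) (hAB : RCLike.re (inner 𝕜 (A ψ) (B ψ)) ≤ 0) {c : ℝ} (hc : 0 ≤ c) :
    ‖A‖ ≤ ‖A - (c : 𝕜) • B‖ := by
  have hvec : ‖A ψ‖ ≤ ‖A ψ - (c : 𝕜) • B ψ‖ := by
    rw [← sq_le_sq₀ (norm_nonneg _) (norm_nonneg _), norm_sub_sq (𝕜 := 𝕜), inner_smul_right,
      RCLike.re_ofReal_mul]
    nlinarith [mul_nonneg hc (neg_nonneg.2 hAB), sq_nonneg ‖(c : 𝕜) • B ψ‖]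
  rw [← hA]
  exact hvec.trans ((A - (c : 𝕜) • B).unit_le_opNorm ψ hψ.le)

open ContinuousLinearMap

variable [CompleteSpace V]

theorem adjoint_apply_apply_of_norm_eq [CompleteSpace W] {A : V →L[𝕜] W} {ψ : V}
    (hψ : ‖A ψ‖ = ‖A‖ * ‖ψ‖) : adjoint A (A ψ) = ((‖A‖ ^ 2 : ℝ) : 𝕜) • ψ := by
  have hle : ‖adjoint A (A ψ)‖ ≤ ‖A‖ ^ 2 * ‖ψ‖ := by
    simpa [hψ, sq, mul_assoc] using (adjoint A).le_opNorm (A ψ)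
  have hinner : RCLike.re (inner 𝕜 (adjoint A (A ψ)) ψ) = (‖A‖ * ‖ψ‖) ^ 2 := by
    rw [adjoint_inner_left, inner_self_eq_norm_sq, hψ]
  have hsq : ‖adjoint A (A ψ) - ((‖A‖ ^ 2 : ℝ) : 𝕜) • ψ‖ ^ 2 ≤ 0 := by
    rw [norm_sub_sq (𝕜 := 𝕜), inner_smul_right, RCLike.re_ofReal_mul, hinner, norm_smul,
      RCLike.norm_ofReal, abs_of_nonneg (sq_nonneg _)]
    nlinarith [pow_le_pow_left₀ (norm_nonneg _) hle 2]
  rw [← sub_eq_zero, ← norm_eq_zero]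
  exact pow_eq_zero_iff two_ne_zero |>.1 (le_antisymm hsq (sq_nonneg _))

theorem inner_apply_apply_of_norm_eq [CompleteSpace W] {A : V →L[𝕜] W} {ψ : V}
    (hψ : ‖A ψ‖ = ‖A‖ * ‖ψ‖) (φ : V) :
    inner 𝕜 (A ψ) (A φ) = ((‖A‖ ^ 2 : ℝ) : 𝕜) * inner 𝕜 ψ φ := by
  rw [← adjoint_inner_left, adjoint_apply_apply_of_norm_eq hψ, inner_smul_left, RCLike.conj_ofReal]

theorem re_inner_commutator_eq_zero {A H : V →L[𝕜] V} (hH : IsSelfAdjoint H) {ψ : V}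
    (hψ : ‖A ψ‖ = ‖A‖ * ‖ψ‖) :
    RCLike.re (inner 𝕜 (A ψ) ((RCLike.I : 𝕜) • (H (A ψ) - A (H ψ)))) = 0 := by
  have him (φ : V) : RCLike.im (inner 𝕜 φ (H φ)) = 0 := hH.isSymmetric.im_inner_self_apply φ
  rw [inner_smul_right, RCLike.I_mul_re, inner_sub_right, map_sub, him,
    inner_apply_apply_of_norm_eq hψ, RCLike.im_ofReal_mul, him]
  simp

theorem re_inner_jump_le_zero (A K : V →L[𝕜] V) {ψ : V} (hψ : ‖A ψ‖ = ‖A‖ * ‖ψ‖) :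
    RCLike.re (inner 𝕜 (A ψ) (adjoint K (A (K ψ)) -
      (1 / 2 : 𝕜) • (adjoint K (K (A ψ)) + A (adjoint K (K ψ))))) ≤ 0 := by
  have hcross : RCLike.re (inner 𝕜 (K (A ψ)) (A (K ψ))) ≤ ‖K (A ψ)‖ * (‖A‖ * ‖K ψ‖) :=
    (re_inner_le_norm _ _).trans (by gcongr; exact A.le_opNorm _)
  have hhalf : (1 / 2 : 𝕜) = ((1 / 2 : ℝ) : 𝕜) := by
    rw [RCLike.ofReal_div, RCLike.ofReal_one, RCLike.ofReal_ofNat]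
  rw [inner_sub_right, inner_smul_right, inner_add_right, inner_apply_apply_of_norm_eq hψ,
    adjoint_inner_right, adjoint_inner_right, adjoint_inner_right, map_sub, hhalf,
    RCLike.re_ofReal_mul, map_add, RCLike.re_ofReal_mul, inner_self_eq_norm_sq,
    inner_self_eq_norm_sq]
  nlinarith [sq_nonneg (‖K (A ψ)‖ - ‖A‖ * ‖K ψ‖)]

end NormAttainingVectors

section Dissipativity

open Filter Topology Set

variable {E : Type*} [NormedAddCommGroup E] [NormedSpace ℝ E]

/-- A map `P` of a normed space is dissipative if `‖a‖ ≤ ‖a - c • P a‖` for all `a` and `c ≥ 0`. -/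
def IsDissipative (P : E → E) : Prop :=
  ∀ (a : E) (c : ℝ), 0 ≤ c → ‖a‖ ≤ ‖a - c • P a‖

theorem IsDissipative.eventually_slope_norm_lt {P : E → E} (hP : IsDissipative P)
    (hPc : Continuous P) {f : ℝ → E} {x : ℝ} (hf : HasDerivAt f (P (f x)) x) {r : ℝ} (hr : 0 < r) :
    ∀ᶠ z in 𝓝[>] x, slope (fun s => ‖f s‖) x z < r := by
  have hslope : Tendsto (slope f x) (𝓝[>] x) (𝓝 (P (f x))) :=
    (hasDerivAt_iff_tendsto_slope.1 hf).mono_left (nhdsWithin_mono _ fun z hz => ne_of_gt hz)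
  have hPf : Tendsto (fun z => P (f z)) (𝓝[>] x) (𝓝 (P (f x))) :=
    (hPc.continuousAt.comp hf.continuousAt).tendsto.mono_left nhdsWithin_le_nhds
  have hdiff : Tendsto (fun z => ‖slope f x z - P (f z)‖) (𝓝[>] x) (𝓝 0) := by
    simpa using (hslope.sub hPf).norm
  filter_upwards [hdiff.eventually (gt_mem_nhds hr), self_mem_nhdsWithin] with z hz hxz
  have hzx : 0 < z - x := sub_pos.2 hxz
  refine lt_of_le_of_lt ?_ hz
  have hstep : ‖f z‖ - ‖f x‖ ≤ ‖(f z - (z - x) • P (f z)) - f x‖ :=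
    (sub_le_sub_right (hP (f z) _ hzx.le) _).trans (norm_sub_norm_le _ _)
  have hscale : ‖(f z - (z - x) • P (f z)) - f x‖ = (z - x) * ‖slope f x z - P (f z)‖ := by
    rw [← norm_smul_of_nonneg hzx.le, smul_sub, sub_smul_slope, vsub_eq_sub, sub_right_comm]
  rw [slope_def_field, div_le_iff₀ hzx, mul_comm, ← hscale]
  exact hstep

theorem IsDissipative.norm_le_of_hasDerivAt {P : E → E} (hP : IsDissipative P)
    (hPc : Continuous P) {f : ℝ → E} (hf : ∀ s, HasDerivAt f (P (f s)) s) {t : ℝ} (ht : 0 ≤ t) :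
    ‖f t‖ ≤ ‖f 0‖ := by
  have hfc : Continuous f := continuous_iff_continuousAt.2 fun s => (hf s).continuousAt
  exact image_le_of_liminf_slope_right_le_deriv_boundary (B := fun _ => ‖f 0‖) (B' := fun _ => 0)
    hfc.norm.continuousOn le_rfl continuousOn_const (fun _ _ => hasDerivWithinAt_const _ _ _)
    (fun x _ _ hr => (hP.eventually_slope_norm_lt hPc (hf x) hr).frequently) (right_mem_Icc.2 ht)

theorem IsLindblad.re_inner_le_zero {m : Type*} [Fintype m] [DecidableEq m]
    {Φ : Matrix m m ℂ →ₗ[ℂ] Matrix m m ℂ} (hΦ : IsLindblad Φ) {A : Matrix m m ℂ}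
    {ψ : EuclideanSpace ℂ m} (hψ : ‖Matrix.toEuclideanCLM (𝕜 := ℂ) A ψ‖ =
      ‖Matrix.toEuclideanCLM (𝕜 := ℂ) A‖ * ‖ψ‖) :
    RCLike.re (inner ℂ (Matrix.toEuclideanCLM (𝕜 := ℂ) A ψ)
      (Matrix.toEuclideanCLM (𝕜 := ℂ) (Φ A) ψ)) ≤ 0 := by
  obtain ⟨H, ℓ, K, hH, hK⟩ := hΦ
  set T := Matrix.toEuclideanCLM (n := m) (𝕜 := ℂ)
  have happly : T (Φ A) ψ = (RCLike.I : ℂ) • (T H (T A ψ) - T A (T H ψ)) +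
      ∑ j, (star (T (K j)) (T A (T (K j) ψ)) - (1 / 2 : ℂ) •
        (star (T (K j)) (T (K j) (T A ψ)) + T A (star (T (K j)) (T (K j) ψ)))) := by
    simp [hK, map_star, mul_assoc]
  have hH' : IsSelfAdjoint (T H) := by rw [IsSelfAdjoint, ← map_star, hH]
  rw [happly, inner_add_right, inner_sum, map_add, map_sum]
  exact add_nonpos (re_inner_commutator_eq_zero hH' hψ).le
    (Finset.sum_nonpos fun j _ => re_inner_jump_le_zero _ _ hψ)

theorem IsLindblad.isDissipative {m : Type*} [Fintype m] [DecidableEq m]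
    {Φ : Matrix m m ℂ →ₗ[ℂ] Matrix m m ℂ} (hΦ : IsLindblad Φ) : IsDissipative Φ := by
  intro A c hc
  rcases isEmpty_or_nonempty m with hm | hm
  · simp [Subsingleton.elim A 0]
  let T := Matrix.toEuclideanCLM (n := m) (𝕜 := ℂ)
  obtain ⟨ψ, hψ, hAψ⟩ := exists_norm_eq_opNorm (T A)
  have hre := hΦ.re_inner_le_zero (A := A) (ψ := ψ) (by rw [hψ, mul_one]; exact hAψ)
  have hT : T (A - c • Φ A) = T A - (c : ℂ) • T (Φ A) := by
    rw [← Complex.coe_smul, map_sub, map_smul]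
  rw [← Matrix.l2_opNorm_toEuclideanCLM A, ← Matrix.l2_opNorm_toEuclideanCLM (A - _)]
  exact (norm_le_norm_sub_smul_of_re_inner_nonpos hψ hAψ hre hc).trans_eq (congrArg _ hT.symm)

end Dissipativity

section Flow

open Set

variable {E : Type*} [NormedAddCommGroup E] [NormedSpace ℂ E]

/-- The one-parameter group `exp (t P)` generated by a bounded operator `P`. -/
noncomputable def flow (P : E →L[ℂ] E) (t : ℝ) : E →L[ℂ] E :=
  NormedSpace.exp ((t : ℂ) • P)

theorem flow_zero (P : E →L[ℂ] E) : flow P 0 = 1 := by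
  simp [flow]

theorem flow_commute {Q P : E →L[ℂ] E} (h : Commute Q P) (t : ℝ) : Commute Q (flow P t) :=
  (h.smul_right _).exp_right

variable [CompleteSpace E]

theorem hasDerivAt_flow (P : E →L[ℂ] E) (t : ℝ) : HasDerivAt (flow P) (P * flow P t) t := by
  change HasDerivAt (fun t : ℝ => NormedSpace.exp ((t : ℂ) • P)) _ t
  simpa [Function.comp_def, flow] using
    (hasDerivAt_exp_smul_const' (𝕂 := ℂ) P (t : ℂ)).scomp t Complex.ofRealCLM.hasDerivAt

theorem hasDerivAt_flow_apply (P : E →L[ℂ] E) (a : E) (t : ℝ) :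
    HasDerivAt (fun t => flow P t a) (P (flow P t a)) t :=
  ((ContinuousLinearMap.apply ℂ E a).restrictScalars ℝ).hasFDerivAt.comp_hasDerivAt t
    (hasDerivAt_flow P t)

theorem IsDissipative.norm_flow_apply_le {P : E →L[ℂ] E} (hP : IsDissipative P) {t : ℝ}
    (ht : 0 ≤ t) (a : E) : ‖flow P t a‖ ≤ ‖a‖ := by
  simpa [flow_zero] using
    hP.norm_le_of_hasDerivAt P.continuous (fun s => hasDerivAt_flow_apply P a s) ht

theorem hasDerivAt_flow_sub_mul_mul_flow (P Q R : E →L[ℂ] E) (t s : ℝ) :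
    HasDerivAt (fun s => flow P (t - s) * (Q * flow R s))
      (flow P (t - s) * ((Q * R - P * Q) * flow R s)) s := by
  have hP : HasDerivAt (fun s => flow P (t - s)) (-(flow P (t - s) * P)) s := by
    rw [← (flow_commute (Commute.refl P) (t - s)).eq]
    simpa [Function.comp_def] using
      (hasDerivAt_flow P (t - s)).scomp s ((hasDerivAt_id s).const_sub t)
  refine (hP.mul ((hasDerivAt_flow R s).const_mul Q)).congr_deriv ?_
  noncomm_ring

theorem norm_duhamel_le {P Q R : E →L[ℂ] E} (hP : IsDissipative P) (a : E) {b b' : ℝ → ℝ}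
    (hb : ∀ s, HasDerivAt b (b' s) s) (hb0 : b 0 = 0)
    (hbound : ∀ s, 0 ≤ s → ‖(Q * R - P * Q) (flow R s a)‖ ≤ b' s) {t : ℝ} (ht : 0 ≤ t) :
    ‖Q (flow R t a) - flow P t (Q a)‖ ≤ b t := by
  let f := fun s => flow P (t - s) (Q (flow R s a)) - flow P t (Q a)
  have hf (s : ℝ) : HasDerivAt f (flow P (t - s) ((Q * R - P * Q) (flow R s a))) s :=
    (((ContinuousLinearMap.apply ℂ E a).restrictScalars ℝ).hasFDerivAt.comp_hasDerivAt s
      (hasDerivAt_flow_sub_mul_mul_flow P Q R t s)).sub_const _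
  have hft : ‖f t‖ ≤ b t := image_norm_le_of_norm_deriv_right_le_deriv_boundary (a := 0)
    (continuous_iff_continuousAt.2 fun s => (hf s).continuousAt).continuousOn
    (fun s _ => (hf s).hasDerivWithinAt) (by simp [f, hb0, flow_zero]) hb
    (fun s hs => (hP.norm_flow_apply_le (sub_nonneg.2 hs.2.le) _).trans (hbound s hs.1))
    (right_mem_Icc.2 ht)
  simpa [f, flow_zero] using hft

end Flow

section Propagation

open Finset

variable {Γ : Type*}

/-- The expansion of `exp (t M) 1_X` to order `n`, with the remainder estimated through
`1_X ≤ 1`. -/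
noncomputable def propagationBound (M : (Γ → ℝ) →ₗ[ℝ] (Γ → ℝ)) (X : Finset Γ) (n : ℕ) (t : ℝ) :
    Γ → ℝ :=
  ∑ k ∈ range n, (t ^ k / k.factorial) • (M ^ k) (Set.indicator X 1) +
    (t ^ n / n.factorial) • (M ^ n) 1

theorem propagationBound_succ_apply (M : (Γ → ℝ) →ₗ[ℝ] (Γ → ℝ)) (X : Finset Γ) (n : ℕ) (t : ℝ)
    (z : Γ) : propagationBound M X (n + 1) t z = Set.indicator X 1 z +
      ∑ k ∈ range n, t ^ (k + 1) / (k + 1).factorial * (M ^ (k + 1)) (Set.indicator X 1) z +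
      t ^ (n + 1) / (n + 1).factorial * (M ^ (n + 1)) 1 z := by
  simp [propagationBound, sum_range_succ' _ n, add_comm]

theorem propagationBound_succ_zero (M : (Γ → ℝ) →ₗ[ℝ] (Γ → ℝ)) (X : Finset Γ) (n : ℕ) (z : Γ) :
    propagationBound M X (n + 1) 0 z = Set.indicator X 1 z := by
  simp [propagationBound_succ_apply]

theorem hasDerivAt_pow_succ_div_factorial (k : ℕ) (t : ℝ) :
    HasDerivAt (fun t : ℝ => t ^ (k + 1) / (k + 1).factorial) (t ^ k / k.factorial) t := by
  refine ((hasDerivAt_pow (k + 1) t).div_const _).congr_deriv ?_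
  rw [Nat.factorial_succ, Nat.cast_mul, add_tsub_cancel_right,
    mul_div_mul_left _ _ (Nat.cast_ne_zero.2 k.succ_ne_zero)]

theorem hasDerivAt_propagationBound (M : (Γ → ℝ) →ₗ[ℝ] (Γ → ℝ)) (X : Finset Γ) (n : ℕ) (t : ℝ)
    (z : Γ) : HasDerivAt (fun t => propagationBound M X (n + 1) t z)
      (M (propagationBound M X n t) z) t := by
  have hMn : M (propagationBound M X n t) z =
      ∑ k ∈ range n, t ^ k / k.factorial * (M ^ (k + 1)) (Set.indicator X 1) z +
        t ^ n / n.factorial * (M ^ (n + 1)) 1 z := by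
    simp [propagationBound, pow_succ' M, Module.End.mul_apply]
  simp only [propagationBound_succ_apply]
  rw [hMn]
  exact ((HasDerivAt.fun_sum fun k _ =>
    (hasDerivAt_pow_succ_div_factorial k t).mul_const _).const_add _).add
    ((hasDerivAt_pow_succ_div_factorial n t).mul_const _)

variable [DecidableEq Γ] {ℓ : Finset Γ → ℝ} {S S' : Finset (Finset Γ)} {h : Γ → ℝ}

/-- The action `h ↦ M h` of the kernel `M(z, y) = ∑_{Z ∈ S, Z ∋ z, y} ℓ(Z)`. -/
def propagate (ℓ : Finset Γ → ℝ) (S : Finset (Finset Γ)) : (Γ → ℝ) →ₗ[ℝ] (Γ → ℝ) where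
  toFun h z := ∑ Z ∈ S with z ∈ Z, ℓ Z * ∑ y ∈ Z, h y
  map_add' h h' := by
    ext z
    simp [sum_add_distrib, mul_add]
  map_smul' c h := by
    ext z
    simp only [Pi.smul_apply, smul_eq_mul, ← mul_sum, mul_left_comm _ c, RingHom.id_apply]

theorem propagate_apply (ℓ : Finset Γ → ℝ) (S : Finset (Finset Γ)) (h : Γ → ℝ) (z : Γ) :
    propagate ℓ S h z = ∑ Z ∈ S with z ∈ Z, ℓ Z * ∑ y ∈ Z, h y := rfl

theorem propagate_nonneg (hℓ : ∀ Z ∈ S, 0 ≤ ℓ Z) (hh : 0 ≤ h) : 0 ≤ propagate ℓ S h := fun _ =>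
  sum_nonneg fun Z hZ => mul_nonneg (hℓ Z (mem_of_mem_filter Z hZ)) (sum_nonneg fun y _ => hh y)

theorem propagate_pow_nonneg (hℓ : ∀ Z ∈ S, 0 ≤ ℓ Z) (hh : 0 ≤ h) (n : ℕ) :
    0 ≤ (propagate ℓ S ^ n) h := by
  induction n with
  | zero => simpa using hh
  | succ n ih =>
    rw [pow_succ', Module.End.mul_apply]
    exact propagate_nonneg hℓ ih

theorem sum_filter_not_disjoint_le (S : Finset (Finset Γ)) (T : Finset Γ) {c : Finset Γ → ℝ}
    (hc : ∀ Z ∈ S, 0 ≤ c Z) :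
    ∑ Z ∈ S with ¬Disjoint T Z, c Z ≤ ∑ z ∈ T, ∑ Z ∈ S with z ∈ Z, c Z := by
  simp only [sum_filter]
  rw [sum_comm]
  refine sum_le_sum fun Z hZ => ?_
  have hnonneg (z : Γ) (_ : z ∈ T) : 0 ≤ if z ∈ Z then c Z else 0 := by
    split_ifs
    exacts [hc Z hZ, le_rfl]
  split_ifs with hTZ
  · exact sum_nonneg hnonneg
  · obtain ⟨z, hz, hzZ⟩ := not_disjoint_iff.1 hTZ
    simpa [hzZ] using single_le_sum hnonneg hz

theorem sum_filter_not_disjoint_le_sum_propagate (hS : S ⊆ S') (hℓ : ∀ Z ∈ S', 0 ≤ ℓ Z)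
    (hh : 0 ≤ h) (T : Finset Γ) :
    ∑ Z ∈ S with ¬Disjoint T Z, ℓ Z * ∑ y ∈ Z, h y ≤ ∑ z ∈ T, propagate ℓ S' h z := by
  have hnonneg (Z : Finset Γ) (hZ : Z ∈ S') : 0 ≤ ℓ Z * ∑ y ∈ Z, h y :=
    mul_nonneg (hℓ Z hZ) (sum_nonneg fun y _ => hh y)
  exact (sum_le_sum_of_subset_of_nonneg (filter_subset_filter _ hS)
    fun Z hZ _ => hnonneg Z (mem_of_mem_filter Z hZ)).trans
    (sum_filter_not_disjoint_le S' T hnonneg)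

theorem propagationBound_nonneg (hℓ : ∀ Z ∈ S, 0 ≤ ℓ Z) (X : Finset Γ) (n : ℕ) {t : ℝ}
    (ht : 0 ≤ t) : 0 ≤ propagationBound (propagate ℓ S) X n t := by
  have hindicator : (0 : Γ → ℝ) ≤ Set.indicator X 1 := Set.indicator_nonneg fun _ _ => zero_le_one
  exact add_nonneg (sum_nonneg fun k _ =>
    smul_nonneg (by positivity) (propagate_pow_nonneg hℓ hindicator k))
    (smul_nonneg (by positivity) (propagate_pow_nonneg hℓ zero_le_one n))

end Propagation

section LiebRobinson

open Finset

variable {Γ : Type*} {E : Type*} [NormedAddCommGroup E] [NormedSpace ℂ E]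

/-- A family of bounded operators `D Z` of norm at most `ℓ Z`, labelled by the sets `Z ∈ U`, which
commute when their labels are disjoint and all of whose partial sums are dissipative. It models the
terms `L_Z ⊗ id` of the generator of the dynamics of a finite volume. -/
structure IsLocalFamily (U : Finset (Finset Γ)) (D : Finset Γ → E →L[ℂ] E) (ℓ : Finset Γ → ℝ) :
    Prop where
  nonneg : ∀ Z ∈ U, 0 ≤ ℓ Z
  norm_le : ∀ Z ∈ U, ∀ a, ‖D Z a‖ ≤ ℓ Z * ‖a‖
  empty : D ∅ = 0
  commute : ∀ Z ∈ U, ∀ Z' ∈ U, Disjoint Z Z' → Commute (D Z) (D Z')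
  dissipative : ∀ S ⊆ U, IsDissipative (∑ Z ∈ S, D Z : E →L[ℂ] E)

namespace IsLocalFamily

variable {U S S' T V : Finset (Finset Γ)} {D : Finset Γ → E →L[ℂ] E} {ℓ : Finset Γ → ℝ}
  {X Y Z Λ : Finset Γ} {a : E}

theorem mul_sum_sub_sum_mul [DecidableEq Γ] (hD : IsLocalFamily U D ℓ) (hS : S ⊆ U) (hZ : Z ∈ U) :
    D Z * ∑ Z' ∈ S, D Z' - (∑ Z' ∈ S with Disjoint Z Z', D Z') * D Z =
      ∑ Z' ∈ S with ¬Disjoint Z Z', D Z * D Z' := by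
  have hcomm : Commute (D Z) (∑ Z' ∈ S with Disjoint Z Z', D Z') :=
    Commute.sum_right _ _ _ fun Z' hZ' =>
      hD.commute Z hZ Z' (hS (mem_filter.1 hZ').1) (mem_filter.1 hZ').2
  rw [← hcomm.eq, ← mul_sub, ← sum_filter_add_sum_filter_not S (Disjoint Z), add_sub_cancel_left,
    mul_sum]

theorem norm_apply_le_sum_indicator (hD : IsLocalFamily U D ℓ) (hZ : Z ∈ U)
    (ha : Disjoint Z X → D Z a = 0) :
    ‖D Z a‖ ≤ ‖a‖ * (ℓ Z * ∑ z ∈ Z, Set.indicator (X : Set Γ) 1 z) := by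
  have hindicator (z : Γ) (_ : z ∈ Z) : (0 : ℝ) ≤ Set.indicator (X : Set Γ) 1 z :=
    Set.indicator_nonneg (fun _ _ => zero_le_one) z
  have hℓ := hD.nonneg Z hZ
  by_cases hZX : Disjoint Z X
  · rw [ha hZX, norm_zero]
    exact mul_nonneg (norm_nonneg a) (mul_nonneg hℓ (sum_nonneg hindicator))
  · obtain ⟨z, hzZ, hzX⟩ := not_disjoint_iff.1 hZX
    have hone : (1 : ℝ) ≤ ∑ z ∈ Z, Set.indicator (X : Set Γ) 1 z := by
      simpa [Set.indicator_of_mem (mem_coe.2 hzX)] using single_le_sum hindicator hzZ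
    calc ‖D Z a‖ ≤ ‖a‖ * ℓ Z := (hD.norm_le Z hZ a).trans_eq (mul_comm _ _)
      _ ≤ _ := by gcongr; exact le_mul_of_one_le_right hℓ hone

theorem apply_flow_eq_zero (hD : IsLocalFamily U D ℓ) (hS : S ⊆ U) (hSY : ∀ Z' ∈ S, Z' ⊆ Y)
    (hZ : Z ∈ U) (hZY : Disjoint Z Y) (ha : D Z a = 0) (t : ℝ) :
    D Z (flow (∑ Z' ∈ S, D Z') t a) = 0 := by
  have hcomm : Commute (D Z) (∑ Z' ∈ S, D Z') := Commute.sum_right _ _ _ fun Z' hZ' =>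
    hD.commute Z hZ Z' (hS hZ') (hZY.mono_right (hSY Z' hZ'))
  rw [← mul_apply_eq_comp, (flow_commute hcomm t).eq, mul_apply_eq_comp, ha, map_zero]

variable [CompleteSpace E]

theorem norm_apply_flow_le (hD : IsLocalFamily U D ℓ) (hS : S ⊆ U) (hZ : Z ∈ U) {t : ℝ}
    (ht : 0 ≤ t) (a : E) : ‖D Z (flow (∑ Z' ∈ S, D Z') t a)‖ ≤ ‖a‖ * ℓ Z := by
  rw [mul_comm]
  exact (hD.norm_le Z hZ _).trans (mul_le_mul_of_nonneg_left
    ((hD.dissipative S hS).norm_flow_apply_le ht a) (hD.nonneg Z hZ))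

theorem norm_apply_flow_le_propagationBound_zero (hD : IsLocalFamily U D ℓ) (hS : S ⊆ U)
    (hZ : Z ∈ U) {t : ℝ} (ht : 0 ≤ t) (M : (Γ → ℝ) →ₗ[ℝ] (Γ → ℝ)) (X : Finset Γ) (a : E) :
    ‖D Z (flow (∑ Z ∈ S, D Z) t a)‖ ≤
      ‖a‖ * (ℓ Z * ∑ z ∈ Z, propagationBound M X 0 t z) := by
  rcases Z.eq_empty_or_nonempty with rfl | hne
  · simp [hD.empty]
  have hcard : (1 : ℝ) ≤ Z.card := by exact_mod_cast hne.card_pos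
  have hsum : ∑ z ∈ Z, propagationBound M X 0 t z = Z.card := by simp [propagationBound]
  rw [hsum]
  refine (hD.norm_apply_flow_le hS hZ ht a).trans ?_
  gcongr
  exact le_mul_of_one_le_right (hD.nonneg Z hZ) hcard

variable [DecidableEq Γ]

theorem lieb_robinson (hD : IsLocalFamily U D ℓ) (hS : S ⊆ S') (hS' : S' ⊆ U)
    (ha : ∀ Z ∈ U, Disjoint Z X → D Z a = 0) (n : ℕ) :
    ∀ Z ∈ U, ∀ t : ℝ, 0 ≤ t → ‖D Z (flow (∑ Z' ∈ S, D Z') t a)‖ ≤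
      ‖a‖ * (ℓ Z * ∑ z ∈ Z, propagationBound (propagate ℓ S') X n t z) := by
  induction n with
  | zero =>
    exact fun Z hZ t ht =>
      hD.norm_apply_flow_le_propagationBound_zero (hS.trans hS') hZ ht _ X a
  | succ n ih =>
    intro Z hZ t ht
    have hℓ (Z' : Finset Γ) (hZ' : Z' ∈ S') : 0 ≤ ℓ Z' := hD.nonneg Z' (hS' hZ')
    have hP : IsDissipative (∑ Z' ∈ S with Disjoint Z Z', D Z' : E →L[ℂ] E) :=
      hD.dissipative _ ((filter_subset _ _).trans (hS.trans hS'))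
    have hduhamel := norm_duhamel_le (Q := D Z) (R := ∑ Z' ∈ S, D Z') hP a
      (b := fun s => ‖a‖ * (ℓ Z * ∑ z ∈ Z,
        (propagationBound (propagate ℓ S') X (n + 1) s z - Set.indicator X 1 z)))
      (fun s => ((HasDerivAt.fun_sum fun z _ => (hasDerivAt_propagationBound
        (propagate ℓ S') X n s z).sub_const _).const_mul _).const_mul _)
      (by simp [propagationBound_succ_zero]) ?_ ht
    · have hinitial := (hP.norm_flow_apply_le ht (D Z a)).trans
        (hD.norm_apply_le_sum_indicator hZ (ha Z hZ))
      rw [sum_sub_distrib, mul_sub, mul_sub] at hduhamel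
      linarith [norm_sub_norm_le (D Z (flow (∑ Z' ∈ S, D Z') t a))
        (flow (∑ Z' ∈ S with Disjoint Z Z', D Z') t (D Z a))]
    · intro s hs
      rw [hD.mul_sum_sub_sum_mul (hS.trans hS') hZ, _root_.sum_apply]
      calc _ ≤ ∑ Z' ∈ S with ¬Disjoint Z Z', ℓ Z * (‖a‖ * (ℓ Z' *
              ∑ y ∈ Z', propagationBound (propagate ℓ S') X n s y)) :=
            norm_sum_le_of_le _ fun Z' hZ' => (hD.norm_le Z hZ _).trans
              (mul_le_mul_of_nonneg_left (ih Z' (hS' (hS (mem_filter.1 hZ').1)) s hs)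
                (hD.nonneg Z hZ))
        _ = ‖a‖ * (ℓ Z * ∑ Z' ∈ S with ¬Disjoint Z Z', ℓ Z' *
              ∑ y ∈ Z', propagationBound (propagate ℓ S') X n s y) := by
            simp only [mul_sum, mul_left_comm (ℓ Z)]
        _ ≤ _ := by
            gcongr
            · exact hD.nonneg Z hZ
            · exact sum_filter_not_disjoint_le_sum_propagate hS hℓ
                (propagationBound_nonneg hℓ X n hs) Z

theorem norm_flow_sub_flow_le (hD : IsLocalFamily U D ℓ) (hTV : T ⊆ V) (hV : V ⊆ U) (a : E)
    {b b' : ℝ → ℝ} (hb : ∀ s, HasDerivAt b (b' s) s) (hb0 : b 0 = 0)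
    (hbound : ∀ s, 0 ≤ s → ∑ Z ∈ V \ T, ‖D Z (flow (∑ Z ∈ T, D Z) s a)‖ ≤ b' s) {t : ℝ}
    (ht : 0 ≤ t) :
    ‖flow (∑ Z ∈ V, D Z) t a - flow (∑ Z ∈ T, D Z) t a‖ ≤ b t := by
  rw [norm_sub_rev]
  refine norm_duhamel_le (Q := 1) (hD.dissipative V hV) a hb hb0 (fun s hs => ?_) ht
  rw [one_mul, mul_one, ← norm_neg, ← neg_apply, neg_sub, ← sum_sdiff_eq_sub hTV, _root_.sum_apply]
  exact (norm_sum_le _ _).trans (hbound s hs)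

theorem sum_long_apply_flow_le (hD : IsLocalFamily U D ℓ) (hV : V ⊆ U) (hT : T ⊆ U)
    (hTY : ∀ Z ∈ T, Z ⊆ Y) (ha : ∀ Z ∈ U, Disjoint Z Y → D Z a = 0) {s : ℝ} (hs : 0 ≤ s) :
    ∑ Z ∈ V, ‖D Z (flow (∑ Z ∈ T, D Z) s a)‖ ≤ ‖a‖ * ∑ Z ∈ V with ¬Disjoint Y Z, ℓ Z := by
  have hfar (Z : Finset Γ) (hZ : Z ∈ V) (hne : ‖D Z (flow (∑ Z ∈ T, D Z) s a)‖ ≠ 0) :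
      ¬Disjoint Y Z := fun hYZ => hne <| by
    rw [hD.apply_flow_eq_zero hT hTY (hV hZ) hYZ.symm (ha Z (hV hZ) hYZ.symm), norm_zero]
  rw [← sum_filter_of_ne hfar, mul_sum]
  exact sum_le_sum fun Z hZ => hD.norm_apply_flow_le hT (hV (mem_of_mem_filter Z hZ)) hs a

theorem sum_short_apply_flow_le (hD : IsLocalFamily U D ℓ) (hS : S ⊆ U) (hSΛ : ∀ Z ∈ S, Z ⊆ Λ)
    (hT : T ⊆ S) (ha : ∀ Z ∈ U, Disjoint Z X → D Z a = 0) (n : ℕ) {s : ℝ} (hs : 0 ≤ s) :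
    ∑ Z ∈ S with ¬Z ⊆ Y, ‖D Z (flow (∑ Z ∈ T, D Z) s a)‖ ≤
      ‖a‖ * ∑ y ∈ Λ \ Y, propagate ℓ S (propagationBound (propagate ℓ S) X n s) y := by
  have hℓ (Z : Finset Γ) (hZ : Z ∈ S) : 0 ≤ ℓ Z := hD.nonneg Z (hS hZ)
  have hexit : {Z ∈ S | ¬Z ⊆ Y} ⊆ {Z ∈ S | ¬Disjoint (Λ \ Y) Z} :=
    monotone_filter_right S fun Z hZ hZY => by
      obtain ⟨y, hy, hyY⟩ := not_subset.1 hZY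
      exact not_disjoint_iff.2 ⟨y, mem_sdiff.2 ⟨hSΛ Z hZ hy, hyY⟩, hy⟩
  calc _ ≤ ∑ Z ∈ S with ¬Disjoint (Λ \ Y) Z, ‖D Z (flow (∑ Z ∈ T, D Z) s a)‖ :=
        sum_le_sum_of_subset_of_nonneg hexit fun _ _ _ => norm_nonneg _
    _ ≤ ‖a‖ * ∑ Z ∈ S with ¬Disjoint (Λ \ Y) Z,
          ℓ Z * ∑ z ∈ Z, propagationBound (propagate ℓ S) X n s z := by
        rw [mul_sum]
        exact sum_le_sum fun Z hZ =>
          hD.lieb_robinson hT hS ha n Z (hS (mem_of_mem_filter Z hZ)) s hs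
    _ ≤ _ := by
        gcongr
        exact sum_filter_not_disjoint_le_sum_propagate subset_rfl hℓ
          (propagationBound_nonneg hℓ X n hs) _

theorem norm_flow_sub_flow_filter_subset_le (hD : IsLocalFamily U D ℓ) (hS : S ⊆ U)
    (hSΛ : ∀ Z ∈ S, Z ⊆ Λ) (hXY : X ⊆ Y) (ha : ∀ Z ∈ U, Disjoint Z X → D Z a = 0) (n : ℕ) {t : ℝ}
    (ht : 0 ≤ t) :
    ‖flow (∑ Z ∈ U, D Z) t a - flow (∑ Z ∈ S with Z ⊆ Y, D Z) t a‖ ≤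
      ‖a‖ * (t * ∑ Z ∈ U \ S with ¬Disjoint Y Z, ℓ Z +
        ∑ y ∈ Λ \ Y, propagationBound (propagate ℓ S) X (n + 1) t y) := by
  have hSY : {Z ∈ S | Z ⊆ Y} ⊆ S := filter_subset _ _
  refine hD.norm_flow_sub_flow_le (hSY.trans hS) subset_rfl a
    (b := fun s => ‖a‖ * (s * ∑ Z ∈ U \ S with ¬Disjoint Y Z, ℓ Z +
      ∑ y ∈ Λ \ Y, propagationBound (propagate ℓ S) X (n + 1) s y))
    (fun s => (((hasDerivAt_id s).mul_const _).add (HasDerivAt.fun_sum fun y _ =>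
      hasDerivAt_propagationBound (propagate ℓ S) X n s y)).const_mul _) ?_ (fun s hs => ?_) ht
  · have hzero : ∑ y ∈ Λ \ Y, propagationBound (propagate ℓ S) X (n + 1) 0 y = 0 :=
      sum_eq_zero fun y hy => by
        rw [propagationBound_succ_zero, Set.indicator_of_notMem]
        exact fun hyX => (mem_sdiff.1 hy).2 (hXY hyX)
    simp only [zero_mul, hzero, add_zero, mul_zero]
  · rw [← sdiff_union_sdiff_cancel hS hSY,
      sum_union (disjoint_sdiff_self_left.mono_right sdiff_subset), one_mul, mul_add,
      ← filter_not]
    exact add_le_add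
      (hD.sum_long_apply_flow_le sdiff_subset (hSY.trans hS) (fun Z hZ => (mem_filter.1 hZ).2)
        (fun Z hZ hZY => ha Z hZ (hZY.mono_right hXY)) hs)
      (hD.sum_short_apply_flow_le hS hSΛ hSY ha n hs)

theorem norm_flow_filter_subset_sub_le (hD : IsLocalFamily U D ℓ) (hS : S ⊆ U) (Y : Finset Γ)
    (a : E) {t : ℝ} (ht : 0 ≤ t) :
    ‖flow (∑ Z ∈ U with Z ⊆ Y, D Z) t a - flow (∑ Z ∈ S with Z ⊆ Y, D Z) t a‖ ≤
      ‖a‖ * (t * ∑ Z ∈ U \ S with Z ⊆ Y, ℓ Z) := by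
  have hdiff : {Z ∈ U | Z ⊆ Y} \ {Z ∈ S | Z ⊆ Y} = {Z ∈ U \ S | Z ⊆ Y} := by
    grind
  refine hD.norm_flow_sub_flow_le (filter_subset_filter _ hS) (filter_subset _ _) a
    (b := fun s => ‖a‖ * (s * ∑ Z ∈ U \ S with Z ⊆ Y, ℓ Z))
    (fun s => ((hasDerivAt_id s).mul_const _).const_mul _) (by simp) (fun s hs => ?_) ht
  rw [hdiff, one_mul, mul_sum]
  exact sum_le_sum fun Z hZ => hD.norm_apply_flow_le ((filter_subset _ _).trans hS)
    (mem_sdiff.1 (mem_of_mem_filter Z hZ)).1 hs a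

end IsLocalFamily

end LiebRobinson

section FFunction

variable {Γ : Type*} [MetricSpace Γ] {F : ℝ → ℝ}

theorem le_sInf_mul_of_forall {s : Set ℝ≥0∞} {a b : ℝ≥0∞} (hb : b ≠ 0) (hb' : b ≠ ∞)
    (h : ∀ c ∈ s, a ≤ c * b) : a ≤ sInf s * b := by
  rw [← ENNReal.div_le_iff hb hb']
  exact le_sInf fun c hc => (ENNReal.div_le_iff hb hb').2 (h c hc)

theorem IsFFunction.pos_dist (hF : IsFFunction Γ F) (x y : Γ) : 0 < F (dist x y) :=
  hF.pos _ dist_nonneg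

theorem IsFFunction.sum_le (hF : IsFFunction Γ F) (x : Γ) (T : Finset Γ) :
    ∑ y ∈ T, F (dist x y) ≤ (fSum Γ F).toReal := by
  have hsum : ∑ y ∈ T, ENNReal.ofReal (F (dist x y)) ≤ fSum Γ F :=
    (ENNReal.sum_le_tsum T).trans
      (le_iSup (fun x : Γ => ∑' y : Γ, ENNReal.ofReal (F (dist x y))) x)
  rwa [← ENNReal.ofReal_sum_of_nonneg fun y _ => (hF.pos_dist x y).le,
    ENNReal.ofReal_le_iff_le_toReal hF.summable] at hsum

theorem IsFFunction.sum_mul_le (hF : IsFFunction Γ F) (x y : Γ) (T : Finset Γ) :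
    ∑ z ∈ T, F (dist x z) * F (dist z y) ≤ (convConst Γ F).toReal * F (dist x y) := by
  have hconv : ∑' z : Γ, ENNReal.ofReal (F (dist x z)) * ENNReal.ofReal (F (dist z y)) ≤
      convConst Γ F * ENNReal.ofReal (F (dist x y)) :=
    le_sInf_mul_of_forall (ENNReal.ofReal_pos.2 (hF.pos_dist x y)).ne' ENNReal.ofReal_ne_top
      fun C hC => hC x y
  have hsum := (ENNReal.sum_le_tsum T).trans hconv
  simp only [← ENNReal.ofReal_mul (hF.pos_dist _ _).le] at hsum
  rwa [← ENNReal.ofReal_sum_of_nonneg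
      fun z _ => (mul_pos (hF.pos_dist x z) (hF.pos_dist z y)).le,
    ENNReal.ofReal_le_iff_le_toReal (ENNReal.mul_ne_top hF.convolution ENNReal.ofReal_ne_top),
    ENNReal.toReal_mul, ENNReal.toReal_ofReal (hF.pos_dist x y).le] at hsum

theorem IsFFunction.convConst_pos [Nonempty Γ] (hF : IsFFunction Γ F) :
    0 < (convConst Γ F).toReal := by
  obtain ⟨x⟩ := ‹Nonempty Γ›
  have hx := hF.pos_dist x x
  have hsum : F (dist x x) * F (dist x x) ≤ (convConst Γ F).toReal * F (dist x x) := by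
    simpa using hF.sum_mul_le x x {x}
  exact hx.trans_le (le_of_mul_le_mul_right hsum hx)

/-- The sums of `F(d(y, x))` over points `y` at distance at least `s` from a point `x` are bounded
by `B`, uniformly in `x`. Only finite sums are used, so that no summability has to be recorded. -/
def IsTailBound (Γ : Type*) [MetricSpace Γ] (F : ℝ → ℝ) (s B : ℝ) : Prop :=
  ∀ (x : Γ) (T : Finset Γ), (∀ y ∈ T, s ≤ dist y x) → ∑ y ∈ T, F (dist y x) ≤ B

theorem IsTailBound.nonneg [Nonempty Γ] {s B : ℝ} (hB : IsTailBound Γ F s B) : 0 ≤ B := by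
  obtain ⟨x⟩ := ‹Nonempty Γ›
  simpa using hB x ∅

end FFunction

section Kernel

open Finset

variable {Γ : Type*} [MetricSpace Γ]

section Range

variable {S : Finset (Finset Γ)} {Z : Finset Γ} {ρ : ℝ}

theorem dist_le_of_diam_le (hZ : Metric.diam (Z : Set Γ) ≤ ρ) {x y : Γ} (hx : x ∈ Z) (hy : y ∈ Z) :
    dist x y ≤ ρ :=
  (Metric.dist_le_diam_of_mem Z.finite_toSet.isBounded hx hy).trans hZ

theorem exists_lt_dist_of_lt_diam (hρ : 0 ≤ ρ) (hZ : ρ < Metric.diam (Z : Set Γ)) :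
    ∃ x ∈ Z, ∃ y ∈ Z, ρ < dist x y := by
  by_contra! hle
  exact hZ.not_ge (Metric.diam_le_of_forall_dist_le hρ hle)

end Range

variable [DecidableEq Γ]

/-- The weights `ℓ(Z)` of the sets `Z ∈ S`, all contained in the volume `Λ`, satisfy
`∑_{Z ∋ x, y} ℓ(Z) ≤ N F(d(x, y))`: the bound expressed by `‖𝓛‖_F ≤ N` in a finite volume. -/
structure HasFDecay (S : Finset (Finset Γ)) (ℓ : Finset Γ → ℝ) (Λ : Finset Γ) (F : ℝ → ℝ) (N : ℝ) :
    Prop where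
  subset : ∀ Z ∈ S, Z ⊆ Λ
  nonneg : ∀ Z ∈ S, 0 ≤ ℓ Z
  const_nonneg : 0 ≤ N
  sum_le : ∀ x y : Γ, ∑ Z ∈ S with x ∈ Z ∧ y ∈ Z, ℓ Z ≤ N * F (dist x y)

variable {ℓ : Finset Γ → ℝ} {S S' : Finset (Finset Γ)} {X Λ : Finset Γ} {F : ℝ → ℝ}
  {N ρ r B : ℝ}

theorem propagate_pow_indicator_eq_zero (hρ : ∀ Z ∈ S, Metric.diam (Z : Set Γ) ≤ ρ) (n : ℕ)
    (z : Γ) (hz : ∀ x ∈ X, n * ρ < dist z x) :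
    (propagate ℓ S ^ n) (Set.indicator X 1) z = 0 := by
  induction n generalizing z with
  | zero =>
    rw [pow_zero, Module.End.one_apply, Set.indicator_of_notMem]
    exact fun hzX => by simpa using hz z hzX
  | succ n ih =>
    rw [pow_succ', Module.End.mul_apply, propagate_apply]
    refine sum_eq_zero fun Z hZ => mul_eq_zero_of_right _ (sum_eq_zero fun y hy => ih y ?_)
    obtain ⟨hZS, hzZ⟩ := mem_filter.1 hZ
    intro x hx
    have hzx := hz x hx
    push_cast at hzx
    linarith [dist_le_of_diam_le (hρ Z hZS) hzZ hy, dist_triangle z y x]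

namespace HasFDecay

theorem mono (hS : HasFDecay S' ℓ Λ F N) (h : S ⊆ S') : HasFDecay S ℓ Λ F N where
  subset Z hZ := hS.subset Z (h hZ)
  nonneg Z hZ := hS.nonneg Z (h hZ)
  const_nonneg := hS.const_nonneg
  sum_le x y := (sum_le_sum_of_subset_of_nonneg (filter_subset_filter _ h)
    fun Z hZ _ => hS.nonneg Z (mem_of_mem_filter Z hZ)).trans (hS.sum_le x y)

theorem propagate_le (hS : HasFDecay S ℓ Λ F N) {h : Γ → ℝ} (hh : 0 ≤ h) (z : Γ) :
    propagate ℓ S h z ≤ N * ∑ y ∈ Λ, F (dist z y) * h y := by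
  have hkernel : propagate ℓ S h z = ∑ y ∈ Λ, (∑ Z ∈ S with z ∈ Z ∧ y ∈ Z, ℓ Z) * h y := by
    simp only [propagate_apply, sum_mul, mul_sum]
    refine sum_comm' fun Z y => ?_
    simp only [mem_filter]
    exact ⟨fun ⟨⟨hZ, hz⟩, hy⟩ => ⟨⟨hZ, hz, hy⟩, hS.subset Z hZ hy⟩,
      fun ⟨⟨hZ, hz, hy⟩, _⟩ => ⟨⟨hZ, hz⟩, hy⟩⟩
  rw [hkernel, mul_sum]
  refine sum_le_sum fun y _ => ?_
  rw [← mul_assoc]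
  exact mul_le_mul_of_nonneg_right (hS.sum_le z y) (hh y)

theorem propagate_pow_succ_indicator_le (hS : HasFDecay S ℓ Λ F N) (hF : IsFFunction Γ F)
    (hX : X ⊆ Λ) (n : ℕ) (z : Γ) :
    (propagate ℓ S ^ (n + 1)) (Set.indicator X 1) z ≤
      N ^ (n + 1) * (convConst Γ F).toReal ^ n * ∑ x ∈ X, F (dist z x) := by
  have hindicator : (0 : Γ → ℝ) ≤ Set.indicator X 1 := Set.indicator_nonneg fun _ _ => zero_le_one
  have hN := hS.const_nonneg
  induction n generalizing z with
  | zero =>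
    simpa [Set.indicator_apply, sum_ite_mem, inter_eq_right.2 hX] using
      hS.propagate_le hindicator z
  | succ n ih =>
    set C := (convConst Γ F).toReal
    rw [pow_succ' _ (n + 1), Module.End.mul_apply]
    calc _ ≤ N * ∑ y ∈ Λ, F (dist z y) * (propagate ℓ S ^ (n + 1)) (Set.indicator X 1) y :=
          hS.propagate_le (propagate_pow_nonneg hS.nonneg hindicator _) z
      _ ≤ N * ∑ y ∈ Λ, F (dist z y) * (N ^ (n + 1) * C ^ n * ∑ x ∈ X, F (dist y x)) := by
          gcongr with y _
          · exact (hF.pos_dist z y).le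
          · exact ih y
      _ = N ^ (n + 1 + 1) * C ^ n * ∑ x ∈ X, ∑ y ∈ Λ, F (dist z y) * F (dist y x) := by
          rw [sum_comm, mul_sum, mul_sum]
          refine sum_congr rfl fun y _ => ?_
          rw [← mul_sum]
          ring
      _ ≤ N ^ (n + 1 + 1) * C ^ n * ∑ x ∈ X, C * F (dist z x) := by
          gcongr with x _
          exact hF.sum_mul_le z x Λ
      _ = _ := by
          rw [← mul_sum]
          ring

theorem propagate_pow_one_le (hS : HasFDecay S ℓ Λ F N) (hF : IsFFunction Γ F) (n : ℕ) (z : Γ) :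
    (propagate ℓ S ^ n) 1 z ≤ (N * (fSum Γ F).toReal) ^ n := by
  have hN := hS.const_nonneg
  induction n generalizing z with
  | zero => simp
  | succ n ih =>
    rw [pow_succ', Module.End.mul_apply]
    refine (hS.propagate_le (propagate_pow_nonneg hS.nonneg zero_le_one _) z).trans ?_
    calc _ ≤ N * ∑ y ∈ Λ, F (dist z y) * (N * (fSum Γ F).toReal) ^ n := by
          gcongr with y _
          · exact (hF.pos_dist z y).le
          · exact ih y
      _ ≤ N * ((fSum Γ F).toReal * (N * (fSum Γ F).toReal) ^ n) := by
          rw [← sum_mul]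
          gcongr
          exact hF.sum_le z Λ
      _ = _ := by ring

theorem sum_propagate_pow_succ_indicator_le (hS : HasFDecay S ℓ Λ F N) (hF : IsFFunction Γ F)
    (hX : X ⊆ Λ) (hB : IsTailBound Γ F r B) {T : Finset Γ} (hT : ∀ y ∈ T, ∀ x ∈ X, r < dist y x)
    (n : ℕ) :
    ∑ y ∈ T, (propagate ℓ S ^ (n + 1)) (Set.indicator X 1) y ≤
      N ^ (n + 1) * (convConst Γ F).toReal ^ n * (X.card * B) := by
  have hN := hS.const_nonneg
  calc _ ≤ ∑ y ∈ T, N ^ (n + 1) * (convConst Γ F).toReal ^ n * ∑ x ∈ X, F (dist y x) :=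
        sum_le_sum fun y _ => hS.propagate_pow_succ_indicator_le hF hX n y
    _ = N ^ (n + 1) * (convConst Γ F).toReal ^ n * ∑ x ∈ X, ∑ y ∈ T, F (dist y x) := by
        rw [← mul_sum, sum_comm]
    _ ≤ _ := by
        gcongr
        rw [← nsmul_eq_mul]
        exact sum_le_card_nsmul _ _ _ fun x hx => hB x T fun y hy => (hT y hy x hx).le

end HasFDecay

end Kernel

section ExponentialTail

open Finset

/-- For `j + 1 > a` each factor `c ≤ a / e` gains `e⁻¹` over `a`. -/
theorem sum_tail_pow_div_factorial_le {a c : ℝ} (hc : 0 ≤ c) (hca : Real.exp 1 * c ≤ a) (n : ℕ) :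
    ∑ j ∈ range n with a < ((j + 1 : ℕ) : ℝ), c ^ j / (j + 1).factorial ≤ Real.exp 1 := by
  have ha : 0 ≤ a := (by positivity : 0 ≤ Real.exp 1 * c).trans hca
  have hterm (j : ℕ) (hj : a < ((j + 1 : ℕ) : ℝ)) :
      c ^ j / (j + 1).factorial ≤ Real.exp (1 - a) * (a ^ j / j.factorial) := by
    have hc' : c ≤ Real.exp (-1) * a := by
      rw [Real.exp_neg, inv_mul_eq_div, le_div_iff₀ (Real.exp_pos 1)]
      linarith
    have hpow : c ^ j ≤ Real.exp (1 - a) * a ^ j := by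
      refine (pow_le_pow_left₀ hc hc' j).trans ?_
      rw [mul_pow, ← Real.exp_nat_mul]
      push_cast at hj
      gcongr
      linarith
    rw [← mul_div_assoc]
    gcongr
    exact j.le_succ
  calc _ ≤ ∑ j ∈ range n with a < ((j + 1 : ℕ) : ℝ), Real.exp (1 - a) * (a ^ j / j.factorial) :=
        sum_le_sum fun j hj => hterm j (mem_filter.1 hj).2
    _ ≤ Real.exp (1 - a) * ∑ j ∈ range n, a ^ j / j.factorial := by
        rw [mul_sum]
        exact sum_le_sum_of_subset_of_nonneg (filter_subset _ _) fun j _ _ => by positivity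
    _ ≤ Real.exp (1 - a) * Real.exp a := by
        gcongr
        exact Real.sum_le_exp_of_nonneg ha n
    _ = Real.exp 1 := by rw [← Real.exp_add, sub_add_cancel]

end ExponentialTail

section LongSets

open Finset

variable {Γ : Type*} [DecidableEq Γ] {V : Finset (Finset Γ)}

/-- A set with two points that is contained in `Y` is met by at least two points of `Y`, which is
what makes room for the second sum. -/
theorem sum_filter_not_disjoint_add_sum_filter_subset_le {c : Finset Γ → ℝ}
    (hc : ∀ Z ∈ V, 0 ≤ c Z) (hV : ∀ Z ∈ V, Z.Nontrivial) (Y : Finset Γ) :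
    ∑ Z ∈ V with ¬Disjoint Y Z, c Z + ∑ Z ∈ V with Z ⊆ Y, c Z ≤
      ∑ y ∈ Y, ∑ Z ∈ V with y ∈ Z, c Z := by
  simp only [sum_filter]
  rw [sum_comm, ← sum_add_distrib]
  refine sum_le_sum fun Z hZ => ?_
  have hcard : (if ¬Disjoint Y Z then (1 : ℝ) else 0) + (if Z ⊆ Y then 1 else 0) ≤
      (Y ∩ Z).card := by
    by_cases hZY : Z ⊆ Y
    · have htwo : (2 : ℝ) ≤ Z.card := by exact_mod_cast one_lt_card_iff_nontrivial.2 (hV Z hZ)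
      rw [if_pos hZY, inter_eq_right.2 hZY]
      split_ifs <;> linarith
    · rw [if_neg hZY, add_zero]
      split_ifs with hd
      · exact Nat.cast_nonneg _
      · exact_mod_cast card_pos.2 (not_disjoint_iff_nonempty_inter.1 hd)
  calc _ = ((if ¬Disjoint Y Z then (1 : ℝ) else 0) + (if Z ⊆ Y then 1 else 0)) * c Z := by
        simp only [add_mul, ite_mul, one_mul, zero_mul]
    _ ≤ (Y ∩ Z).card * c Z := mul_le_mul_of_nonneg_right hcard (hc Z hZ)
    _ = ∑ y ∈ Y, if y ∈ Z then c Z else 0 := by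
        rw [← sum_filter, sum_const, nsmul_eq_mul, filter_mem_eq_inter]

variable [MetricSpace Γ] {ℓ : Finset Γ → ℝ} {Λ : Finset Γ} {F : ℝ → ℝ} {N ρ B : ℝ}

theorem HasFDecay.sum_filter_mem_le_of_lt_diam (hV : HasFDecay V ℓ Λ F N) (hρ : 0 ≤ ρ)
    (hlong : ∀ Z ∈ V, ρ < Metric.diam (Z : Set Γ)) (hB : IsTailBound Γ F (ρ / 2) B) (w : Γ) :
    ∑ Z ∈ V with w ∈ Z, ℓ Z ≤ N * B := by
  have hfar : {Z ∈ V | w ∈ Z} ⊆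
      {Z ∈ {Z ∈ V | w ∈ Z} | ¬Disjoint {y ∈ Λ | ρ / 2 ≤ dist y w} Z} := fun Z hZ => by
    have hZV := mem_of_mem_filter Z hZ
    refine mem_filter.2 ⟨hZ, not_disjoint_iff.2 ?_⟩
    obtain ⟨x, hx, y, hy, hxy⟩ := exists_lt_dist_of_lt_diam hρ (hlong Z hZV)
    rcases le_or_gt (ρ / 2) (dist x w) with hxw | hxw
    · exact ⟨x, mem_filter.2 ⟨hV.subset Z hZV hx, hxw⟩, hx⟩
    · have hyw : ρ / 2 ≤ dist y w := by linarith [dist_triangle_right x y w]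
      exact ⟨y, mem_filter.2 ⟨hV.subset Z hZV hy, hyw⟩, hy⟩
  have hℓ (Z : Finset Γ) (hZ : Z ∈ {Z ∈ V | w ∈ Z}) : 0 ≤ ℓ Z :=
    hV.nonneg Z (mem_of_mem_filter Z hZ)
  calc _ ≤ ∑ Z ∈ {Z ∈ V | w ∈ Z} with ¬Disjoint {y ∈ Λ | ρ / 2 ≤ dist y w} Z, ℓ Z :=
        sum_le_sum_of_subset_of_nonneg hfar fun Z hZ _ => hℓ Z (mem_of_mem_filter Z hZ)
    _ ≤ ∑ y ∈ Λ with ρ / 2 ≤ dist y w, ∑ Z ∈ {Z ∈ V | w ∈ Z} with y ∈ Z, ℓ Z :=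
        sum_filter_not_disjoint_le _ _ hℓ
    _ ≤ ∑ y ∈ Λ with ρ / 2 ≤ dist y w, N * F (dist y w) := by
        refine sum_le_sum fun y _ => ?_
        rw [filter_filter, dist_comm]
        exact hV.sum_le w y
    _ ≤ N * B := by
        rw [← mul_sum]
        exact mul_le_mul_of_nonneg_left (hB w _ fun y hy => (mem_filter.1 hy).2) hV.const_nonneg

theorem HasFDecay.sum_long_le (hV : HasFDecay V ℓ Λ F N) (hρ : 0 ≤ ρ)
    (hlong : ∀ Z ∈ V, ρ < Metric.diam (Z : Set Γ)) (hB : IsTailBound Γ F (ρ / 2) B)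
    (Y : Finset Γ) :
    ∑ Z ∈ V with ¬Disjoint Y Z, ℓ Z + ∑ Z ∈ V with Z ⊆ Y, ℓ Z ≤ Y.card * (N * B) := by
  have hnontrivial (Z : Finset Γ) (hZ : Z ∈ V) : Z.Nontrivial := by
    obtain ⟨x, hx, y, hy, hxy⟩ := exists_lt_dist_of_lt_diam hρ (hlong Z hZ)
    exact ⟨x, hx, y, hy, dist_pos.1 (hρ.trans_lt hxy)⟩
  refine (sum_filter_not_disjoint_add_sum_filter_subset_le hV.nonneg hnontrivial Y).trans ?_
  rw [← nsmul_eq_mul]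
  exact sum_le_card_nsmul _ _ _ fun w _ => hV.sum_filter_mem_le_of_lt_diam hρ hlong hB w

end LongSets

section Localization

open Finset Filter Topology

variable {Γ : Type*} [MetricSpace Γ] [Nonempty Γ] [DecidableEq Γ] {ℓ : Finset Γ → ℝ}
  {S U : Finset (Finset Γ)} {X Y Λ T : Finset Γ} {F : ℝ → ℝ} {N ρ r B b t : ℝ}

theorem HasFDecay.sum_mul_sum_propagate_pow_succ_indicator_le (hS : HasFDecay S ℓ Λ F N)
    (hF : IsFFunction Γ F) (hX : X ⊆ Λ) (hρ₀ : 0 ≤ ρ)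
    (hρ : ∀ Z ∈ S, Metric.diam (Z : Set Γ) ≤ ρ) (hbρ : b * ρ ≤ r) (hB : IsTailBound Γ F r B)
    (hT : ∀ y ∈ T, ∀ x ∈ X, r < dist y x) (ht : 0 ≤ t)
    (htb : Real.exp 1 * (N * (convConst Γ F).toReal * t) ≤ b) (n : ℕ) :
    ∑ k ∈ range n, t ^ (k + 1) / (k + 1).factorial *
        ∑ y ∈ T, (propagate ℓ S ^ (k + 1)) (Set.indicator X 1) y ≤
      X.card * B * (N * t * Real.exp 1) := by
  set C := (convConst Γ F).toReal
  have hN := hS.const_nonneg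
  have hC : 0 ≤ C := ENNReal.toReal_nonneg
  have hB₀ := hB.nonneg
  have hfew (k : ℕ) (_ : k ∈ range n) (hne : t ^ (k + 1) / (k + 1).factorial *
      ∑ y ∈ T, (propagate ℓ S ^ (k + 1)) (Set.indicator X 1) y ≠ 0) : b < ((k + 1 : ℕ) : ℝ) := by
    refine not_le.1 fun hkb => hne (mul_eq_zero_of_right _ (sum_eq_zero fun y hy => ?_))
    refine propagate_pow_indicator_eq_zero hρ (k + 1) y fun x hx => ?_
    exact ((mul_le_mul_of_nonneg_right hkb hρ₀).trans hbρ).trans_lt (hT y hy x hx)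
  rw [← sum_filter_of_ne hfew]
  calc _ ≤ ∑ k ∈ range n with b < ((k + 1 : ℕ) : ℝ), t ^ (k + 1) / (k + 1).factorial *
          (N ^ (k + 1) * C ^ k * (X.card * B)) := by
        gcongr with k _
        exact hS.sum_propagate_pow_succ_indicator_le hF hX hB hT k
    _ = X.card * B * (N * t) *
          ∑ k ∈ range n with b < ((k + 1 : ℕ) : ℝ), (N * C * t) ^ k / (k + 1).factorial := by
        rw [mul_sum]
        refine sum_congr rfl fun k _ => ?_
        ring
    _ ≤ X.card * B * (N * t) * Real.exp 1 := by
        gcongr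
        exact sum_tail_pow_div_factorial_le (by positivity) htb n
    _ = _ := by ring

theorem HasFDecay.sum_propagationBound_succ_le (hS : HasFDecay S ℓ Λ F N) (hF : IsFFunction Γ F)
    (hX : X ⊆ Λ) (hρ₀ : 0 ≤ ρ) (hρ : ∀ Z ∈ S, Metric.diam (Z : Set Γ) ≤ ρ) (hr : 0 ≤ r)
    (hbρ : b * ρ ≤ r) (hB : IsTailBound Γ F r B) (hT : ∀ y ∈ T, ∀ x ∈ X, r < dist y x)
    (ht : 0 ≤ t) (htb : Real.exp 1 * (N * (convConst Γ F).toReal * t) ≤ b) (n : ℕ) :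
    ∑ y ∈ T, propagationBound (propagate ℓ S) X (n + 1) t y ≤
      X.card * B * (N * t * Real.exp 1) +
        T.card * ((t * (N * (fSum Γ F).toReal)) ^ (n + 1) / (n + 1).factorial) := by
  have hindicator (y : Γ) (hy : y ∈ T) : Set.indicator (X : Set Γ) (1 : Γ → ℝ) y = 0 :=
    Set.indicator_of_notMem (fun hyX => (hr.trans_lt (hT y hy y hyX)).ne' (dist_self y)) 1
  simp only [propagationBound_succ_apply, sum_add_distrib]
  rw [sum_eq_zero hindicator, zero_add, sum_comm]
  simp only [← mul_sum]
  refine add_le_add (hS.sum_mul_sum_propagate_pow_succ_indicator_le hF hX hρ₀ hρ hbρ hB hT ht htb n)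
    ?_
  rw [mul_pow, mul_div_right_comm, mul_left_comm, ← nsmul_eq_mul T.card]
  gcongr
  exact sum_le_card_nsmul _ _ _ fun y _ => hS.propagate_pow_one_le hF (n + 1) y

variable {E : Type*} [NormedAddCommGroup E] [NormedSpace ℂ E] [CompleteSpace E]
  {D : Finset Γ → E →L[ℂ] E} {a : E} {B₁ B₂ : ℝ}

theorem IsLocalFamily.norm_flow_sub_flow_le_add (hD : IsLocalFamily U D ℓ)
    (hU : HasFDecay U ℓ Λ F N) (hF : IsFFunction Γ F) (hXY : X ⊆ Y) (hX : X ⊆ Λ)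
    (ha : ∀ Z ∈ U, Disjoint Z X → D Z a = 0) (hr : 0 ≤ r)
    (hY : ∀ y ∈ Λ \ Y, ∀ x ∈ X, r < dist y x) (hρ : 0 ≤ ρ) (hbρ : b * ρ ≤ r)
    (hB₁ : IsTailBound Γ F (ρ / 2) B₁) (hB₂ : IsTailBound Γ F r B₂) (ht : 0 ≤ t)
    (htb : Real.exp 1 * (N * (convConst Γ F).toReal * t) ≤ b) (n : ℕ) :
    ‖flow (∑ Z ∈ U, D Z) t a - flow (∑ Z ∈ U with Z ⊆ Y, D Z) t a‖ ≤
      ‖a‖ * (N * t * (Y.card * B₁ + X.card * B₂ * Real.exp 1) + (Λ \ Y).card *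
        ((t * (N * (fSum Γ F).toReal)) ^ (n + 1) / (n + 1).factorial)) := by
  set S : Finset (Finset Γ) := {Z ∈ U | Metric.diam (Z : Set Γ) ≤ ρ}
  have hS : S ⊆ U := filter_subset _ _
  have hshort := (hU.mono hS).sum_propagationBound_succ_le hF hX hρ
    (fun Z hZ => (mem_filter.1 hZ).2) hr hbρ hB₂ hY ht htb n
  have hlong := (hU.mono (sdiff_subset (t := S))).sum_long_le hρ (fun Z hZ => by
    simpa [S, (mem_sdiff.1 hZ).1] using (mem_sdiff.1 hZ).2) hB₁ Y
  have hfull := hD.norm_flow_sub_flow_filter_subset_le hS (fun Z hZ => hU.subset Z (hS hZ)) hXY ha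
    n ht
  have hcut := hD.norm_flow_filter_subset_sub_le hS Y a ht
  rw [norm_sub_rev] at hcut
  refine ((norm_sub_le_norm_sub_add_norm_sub _ _ _).trans (add_le_add hfull hcut)).trans ?_
  rw [← mul_add]
  refine mul_le_mul_of_nonneg_left ?_ (norm_nonneg a)
  linarith [mul_le_mul_of_nonneg_left hlong ht]

theorem IsLocalFamily.norm_flow_sub_flow_filter_le (hD : IsLocalFamily U D ℓ)
    (hU : HasFDecay U ℓ Λ F N) (hF : IsFFunction Γ F) (hXY : X ⊆ Y) (hX : X ⊆ Λ)
    (ha : ∀ Z ∈ U, Disjoint Z X → D Z a = 0) (hr : 0 ≤ r)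
    (hY : ∀ y ∈ Λ \ Y, ∀ x ∈ X, r < dist y x) (hρ : 0 ≤ ρ) (hbρ : b * ρ ≤ r)
    (hB₁ : IsTailBound Γ F (ρ / 2) B₁) (hB₂ : IsTailBound Γ F r B₂) (ht : 0 ≤ t)
    (htb : Real.exp 1 * (N * (convConst Γ F).toReal * t) ≤ b) :
    ‖flow (∑ Z ∈ U, D Z) t a - flow (∑ Z ∈ U with Z ⊆ Y, D Z) t a‖ ≤
      ‖a‖ * (N * t * (Y.card * B₁ + X.card * B₂ * Real.exp 1)) := by
  have hfactorial := (FloorSemiring.tendsto_pow_div_factorial_atTop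
    (t * (N * (fSum Γ F).toReal))).comp (tendsto_add_atTop_nat 1)
  simpa using ge_of_tendsto' (((hfactorial.const_mul ((Λ \ Y).card : ℝ)).const_add _).const_mul _)
    (hD.norm_flow_sub_flow_le_add hU hF hXY hX ha hr hY hρ hbρ hB₁ hB₂ ht htb)

end Localization

theorem map_flow_apply {E E' : Type*} [NormedAddCommGroup E] [NormedSpace ℂ E]
    [CompleteSpace E] [NormedAddCommGroup E'] [NormedSpace ℂ E'] [CompleteSpace E']
    {J : E →L[ℂ] E'} {P : E →L[ℂ] E} {R : E' →L[ℂ] E'} (h : ∀ a, J (P a) = R (J a)) (t : ℝ)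
    (a : E) : J (flow P t a) = flow R t (J a) := by
  have hpow : ∀ n : ℕ, J ((((t : ℂ) • P) ^ n) a) = (((t : ℂ) • R) ^ n) (J a) := fun n => by
    induction n with
    | zero => simp
    | succ n ih =>
      rw [pow_succ', pow_succ', mul_apply_eq_comp, mul_apply_eq_comp, _root_.smul_apply, map_smul,
        h, ih, _root_.smul_apply]
  have hP := ((NormedSpace.exp_series_hasSum_exp' (𝕂 := ℂ) ((t : ℂ) • P)).mapL
    (ContinuousLinearMap.apply ℂ E a)).mapL J
  have hR := (NormedSpace.exp_series_hasSum_exp' (𝕂 := ℂ) ((t : ℂ) • R)).mapL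
    (ContinuousLinearMap.apply ℂ E' (J a))
  simp only [ContinuousLinearMap.apply_apply, map_smul, hpow] at hP hR
  exact hP.unique hR

section Interaction

open Finset

variable {Γ : Type*} [DecidableEq Γ] {ι : Γ → Type*}
  [∀ x, Fintype (ι x)] {X Y Z Λ : Finset Γ}

namespace Interaction

/-- The term `L_Z ⊗ id` of the generator on `𝒜_Λ`, with the value `0` unless `Z ⊆ Λ`. -/
noncomputable def localTerm (L : Interaction ι) (Λ Z : Finset Γ) : Obs ι Λ →L[ℂ] Obs ι Λ :=
  if h : Z ⊆ Λ then LinearMap.toContinuousLinearMap (extend h (L.term Z)) else 0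

theorem localTerm_apply (L : Interaction ι) (h : Z ⊆ Λ) (A : Obs ι Λ) :
    L.localTerm Λ Z A = extend h (L.term Z) A := by
  simp [localTerm, h]

theorem generator_eq_sum_localTerm (L : Interaction ι) (Λ : Finset Γ) :
    L.generator Λ = ∑ Z ∈ Λ.powerset, L.localTerm Λ Z := by
  ext1 A
  rw [generator, ← sum_attach Λ.powerset]
  simp only [LinearMap.coe_toContinuousLinearMap', LinearMap.sum_apply, _root_.sum_apply]
  exact sum_congr rfl fun Z _ => (L.localTerm_apply _ A).symm

theorem commute_localTerm (L : Interaction ι) {Z' : Finset Γ} (hZ : Z ⊆ Λ) (hZ' : Z' ⊆ Λ)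
    (hd : Disjoint Z Z') : Commute (L.localTerm Λ Z) (L.localTerm Λ Z') := by
  ext1 A
  simp only [mul_apply_eq_comp, L.localTerm_apply hZ, L.localTerm_apply hZ']
  exact extend_comm_of_disjoint hZ hZ' hd (L.term Z) (L.term Z') A

theorem localTerm_empty (L : Interaction ι) (Λ : Finset Γ) : L.localTerm Λ ∅ = 0 := by
  classical
  ext1 A
  rw [L.localTerm_apply (empty_subset Λ), ← embed_refl A,
    extend_embed_of_disjoint _ subset_rfl (disjoint_empty_left Λ) (L.lindblad ∅).map_one]
  rfl

variable [∀ x, DecidableEq (ι x)]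

theorem localTerm_embed_of_disjoint (L : Interaction ι) (hZ : Z ⊆ Λ) (hX : X ⊆ Λ)
    (hd : Disjoint Z X) (A : Obs ι X) : L.localTerm Λ Z (embed hX A) = 0 := by
  rw [L.localTerm_apply hZ]
  exact extend_embed_of_disjoint hZ hX hd (L.lindblad Z).map_one A

theorem isDissipative_sum_localTerm (L : Interaction ι) {S : Finset (Finset Γ)}
    (hS : S ⊆ Λ.powerset) : IsDissipative (∑ Z ∈ S, L.localTerm Λ Z : Obs ι Λ →L[ℂ] Obs ι Λ) := by
  have hterm : ∀ Z ∈ S, IsLindblad (L.localTerm Λ Z : Obs ι Λ →ₗ[ℂ] Obs ι Λ) := fun Z hZ => by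
    have hZΛ := mem_powerset.1 (hS hZ)
    rw [show (L.localTerm Λ Z : Obs ι Λ →ₗ[ℂ] Obs ι Λ) = extend hZΛ (L.term Z) from
      LinearMap.ext (L.localTerm_apply hZΛ)]
    exact (L.lindblad Z).extend hZΛ
  simpa [_root_.sum_apply, IsDissipative] using (isLindblad_sum S hterm).isDissipative

theorem embed_dynamics (L : Interaction ι) (hY : Y ⊆ Λ) (t : ℝ) (B : Obs ι Y) :
    embed hY (L.dynamics Y t B) =
      flow (∑ Z ∈ Λ.powerset with Z ⊆ Y, L.localTerm Λ Z) t (embed hY B) := by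
  have hfilter : Λ.powerset.filter (· ⊆ Y) = Y.powerset := by
    ext Z
    simp only [mem_filter, mem_powerset]
    exact and_iff_right_of_imp fun h => h.trans hY
  rw [hfilter]
  refine map_flow_apply
    (J := LinearMap.toContinuousLinearMap (embedHom (ι := ι) hY : Obs ι Y →ₗ[ℂ] Obs ι Λ))
    (P := L.generator Y) (fun A => ?_) t B
  rw [L.generator_eq_sum_localTerm]
  simp only [_root_.sum_apply, map_sum]
  refine sum_congr rfl fun Z hZ => ?_
  have hZY := mem_powerset.1 hZ
  rw [L.localTerm_apply hZY, L.localTerm_apply (hZY.trans hY)]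
  exact embed_extend hZY hY (L.term Z) A

variable [MetricSpace Γ] {F : ℝ → ℝ}

theorem cbNorm_term_ne_top (L : Interaction ι) (hL : L.fNorm F ≠ ∞) (hZ : Z.Nonempty) :
    cbNorm (L.term Z) ≠ ∞ := by
  obtain ⟨x, hx⟩ := hZ
  obtain ⟨M, hM, hMtop⟩ := sInf_lt_iff.1 (lt_top_iff_ne_top.2 hL)
  refine ne_top_of_le_ne_top (ENNReal.mul_ne_top hMtop.ne ENNReal.ofReal_ne_top)
    (le_trans ?_ (hM x x))
  exact ENNReal.le_tsum (f := fun Z : {Z : Finset Γ // x ∈ Z ∧ x ∈ Z} => cbNorm (L.term Z.1))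
    ⟨Z, hx, hx⟩

theorem sum_cbNorm_term_le (L : Interaction ι) (hF : ∀ r, 0 ≤ r → 0 < F r)
    (hL : L.fNorm F ≠ ∞) (S : Finset (Finset Γ)) (x y : Γ) :
    ∑ Z ∈ S with x ∈ Z ∧ y ∈ Z, (cbNorm (L.term Z)).toReal ≤
      (L.fNorm F).toReal * F (dist x y) := by
  have hpos := hF (dist x y) dist_nonneg
  have htsum : ∑' Z : {Z : Finset Γ // x ∈ Z ∧ y ∈ Z}, cbNorm (L.term Z.1) ≤
      L.fNorm F * ENNReal.ofReal (F (dist x y)) :=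
    le_sInf_mul_of_forall (ENNReal.ofReal_pos.2 hpos).ne' ENNReal.ofReal_ne_top
      fun C hC => hC x y
  have hsum := (ENNReal.sum_le_tsum (S.subtype fun Z => x ∈ Z ∧ y ∈ Z)).trans htsum
  rw [sum_subtype_eq_sum_filter (fun Z => cbNorm (L.term Z))] at hsum
  rw [← ENNReal.toReal_sum fun Z hZ => L.cbNorm_term_ne_top hL ⟨x, (mem_filter.1 hZ).2.1⟩]
  refine (ENNReal.toReal_mono (ENNReal.mul_ne_top hL ENNReal.ofReal_ne_top) hsum).trans ?_
  rw [ENNReal.toReal_mul, ENNReal.toReal_ofReal hpos.le]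

theorem hasFDecay (L : Interaction ι) (hF : ∀ r, 0 ≤ r → 0 < F r) (hL : L.fNorm F ≠ ∞)
    (Λ : Finset Γ) :
    HasFDecay Λ.powerset (fun Z => (cbNorm (L.term Z)).toReal) Λ F (L.fNorm F).toReal where
  subset _ := mem_powerset.1
  nonneg _ _ := ENNReal.toReal_nonneg
  const_nonneg := ENNReal.toReal_nonneg
  sum_le := L.sum_cbNorm_term_le hF hL Λ.powerset

theorem isLocalFamily (L : Interaction ι) (hL : L.fNorm F ≠ ∞) (Λ : Finset Γ) :
    IsLocalFamily Λ.powerset (L.localTerm Λ) fun Z => (cbNorm (L.term Z)).toReal where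
  nonneg _ _ := ENNReal.toReal_nonneg
  norm_le Z hZ A := by
    rcases Z.eq_empty_or_nonempty with rfl | hne
    · rw [L.localTerm_empty, zero_apply, norm_zero]
      positivity
    · rw [L.localTerm_apply (mem_powerset.1 hZ)]
      exact norm_extend_le _ (L.cbNorm_term_ne_top hL hne) A
  empty := L.localTerm_empty Λ
  commute Z hZ Z' hZ' := L.commute_localTerm (mem_powerset.1 hZ) (mem_powerset.1 hZ')
  dissipative S hS := L.isDissipative_sum_localTerm hS

theorem norm_dynamics_sub_le [Nonempty Γ] (L : Interaction ι) (hF : IsFFunction Γ F)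
    (hL : L.fNorm F ≠ ∞) {B₁ B₂ ρ r b : ℝ} (hρ : 0 ≤ ρ) (hr : 0 ≤ r) (hbρ : b * ρ ≤ r)
    (hB₁ : IsTailBound Γ F (ρ / 2) B₁) (hB₂ : IsTailBound Γ F r B₂) (hX : X ⊆ Λ) (A : Obs ι X)
    {t : ℝ} (ht : 0 ≤ t)
    (htb : Real.exp 1 * ((L.fNorm F).toReal * (convConst Γ F).toReal * t) ≤ b) :
    ‖L.dynamics Λ t (embed hX A) - embed (inflationIn_subset Λ X r)
        (L.dynamics (inflationIn Λ X r) t (embed (subset_inflationIn hX hr) A))‖ ≤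
      ‖A‖ * ((L.fNorm F).toReal * t *
        ((inflationIn Λ X r).card * B₁ + X.card * B₂ * Real.exp 1)) := by
  have hfar : ∀ y ∈ Λ \ inflationIn Λ X r, ∀ x ∈ X, r < dist y x := fun y hy x hx =>
    not_le.1 fun hle =>
      (mem_sdiff.1 hy).2 (mem_inflationIn.2 ⟨(mem_sdiff.1 hy).1, x, hx, hle⟩)
  have hfull : L.dynamics Λ t = flow (∑ Z ∈ Λ.powerset, L.localTerm Λ Z) t := by
    rw [← L.generator_eq_sum_localTerm]
    rfl
  rw [L.embed_dynamics, embed_embed, hfull]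
  refine ((L.isLocalFamily hL Λ).norm_flow_sub_flow_filter_le (L.hasFDecay hF.pos hL Λ) hF
    (subset_inflationIn hX hr) hX
    (fun Z hZ hd => L.localTerm_embed_of_disjoint (mem_powerset.1 hZ) hX hd A)
    hr hfar hρ hbρ hB₁ hB₂ ht htb).trans ?_
  have hB₁0 := hB₁.nonneg
  have hB₂0 := hB₂.nonneg
  gcongr
  exact norm_embed_le hX A

end Interaction

end Interaction

section PowerLaw

variable {α β p q d r s δ ε : ℝ}

theorem summable_one_div_one_add_rpow (hε : 0 < ε) :
    Summable fun n : ℕ => 1 / (1 + (n : ℝ)) ^ (1 + ε) := by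
  simpa [add_comm] using
    (summable_nat_add_iff 1).2 (Real.summable_one_div_nat_rpow.2 (by linarith : 1 < 1 + ε))

theorem zetaConst_pos (hε : 0 < ε) : 0 < zetaConst ε :=
  (summable_one_div_one_add_rpow hε).tsum_pos (fun n => by positivity) 0 (by positivity)

theorem powerLaw_pos (α : ℝ) (hr : 0 ≤ r) : 0 < powerLaw α r := by
  unfold powerLaw
  positivity

theorem powerLaw_add (α β : ℝ) (hr : 0 ≤ r) :
    powerLaw (α + β) r = powerLaw α r * powerLaw β r := by
  rw [powerLaw, powerLaw, powerLaw, Real.rpow_add (by positivity), one_div_mul_one_div]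

theorem powerLaw_le_powerLaw (hα : 0 ≤ α) (hr : 0 ≤ r) (hrs : r ≤ s) :
    powerLaw α s ≤ powerLaw α r := by
  unfold powerLaw
  gcongr

theorem powerLaw_le_of_le_two_mul (hα : 0 ≤ α) (hd : 0 ≤ d) (hs : 0 ≤ s) (hds : d ≤ 2 * s) :
    powerLaw α s ≤ 2 ^ α * powerLaw α d := by
  rw [powerLaw, powerLaw, mul_one_div, div_le_div_iff₀ (by positivity) (by positivity), one_mul,
    ← Real.mul_rpow (by positivity) (by positivity)]
  gcongr
  linarith

theorem powerLaw_mul_powerLaw_le (hα : 0 ≤ α) (hp : 0 ≤ p) (hq : 0 ≤ q) (hd : 0 ≤ d)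
    (hdpq : d ≤ p + q) :
    powerLaw α p * powerLaw α q ≤ 2 ^ α * powerLaw α d * (powerLaw α p + powerLaw α q) := by
  have hp0 := (powerLaw_pos α hp).le
  have hq0 := (powerLaw_pos α hq).le
  have hd0 : 0 ≤ 2 ^ α * powerLaw α d := mul_nonneg (by positivity) (powerLaw_pos α hd).le
  rw [mul_add]
  rcases le_total p q with h | h
  · rw [mul_comm (powerLaw α p)]
    exact (mul_le_mul_of_nonneg_right (powerLaw_le_of_le_two_mul hα hd hq (by linarith)) hp0).trans
      (le_add_of_nonneg_right (mul_nonneg hd0 hq0))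
  · exact (mul_le_mul_of_nonneg_right (powerLaw_le_of_le_two_mul hα hd hp (by linarith)) hq0).trans
      (le_add_of_nonneg_left (mul_nonneg hd0 hp0))

theorem powerLaw_half_rpow_le (hβ : 0 ≤ β) (hδ : 0 ≤ δ) (hδ' : δ ≤ 1) (hr : 0 ≤ r) :
    powerLaw β (r ^ (1 - δ) / 2) ≤ 2 ^ β / (1 + r) ^ ((1 - δ) * β) := by
  have hsub : (1 + r) ^ (1 - δ) ≤ 2 * (1 + r ^ (1 - δ) / 2) := by
    have h := Real.rpow_add_le_add_rpow zero_le_one hr (sub_nonneg.2 hδ') (by linarith)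
    rw [Real.one_rpow] at h
    linarith
  rw [powerLaw, div_le_div_iff₀ (by positivity) (by positivity), one_mul,
    ← Real.mul_rpow (by positivity) (by positivity), Real.rpow_mul (by positivity)]
  gcongr

variable {Γ : Type*} [MetricSpace Γ]

theorem IsTailBound.fSum_ne_top {F : ℝ → ℝ} {B : ℝ} (hB : IsTailBound Γ F 0 B)
    (hF : ∀ r, 0 ≤ r → 0 ≤ F r) : fSum Γ F ≠ ∞ := by
  refine ne_top_of_le_ne_top (b := ENNReal.ofReal B) ENNReal.ofReal_ne_top (iSup_le fun x => ?_)
  rw [ENNReal.tsum_eq_iSup_sum]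
  refine iSup_le fun T => ?_
  rw [← ENNReal.ofReal_sum_of_nonneg fun y _ => hF _ dist_nonneg]
  simpa only [dist_comm x] using ENNReal.ofReal_le_ofReal (hB x T fun y _ => dist_nonneg)

theorem convConst_powerLaw_ne_top (hα : 0 ≤ α) (hF : fSum Γ (powerLaw α) ≠ ∞) :
    convConst Γ (powerLaw α) ≠ ∞ := by
  refine ne_top_of_le_ne_top
    (b := ENNReal.ofReal (2 ^ α) * (fSum Γ (powerLaw α) + fSum Γ (powerLaw α)))
    (ENNReal.mul_ne_top ENNReal.ofReal_ne_top (ENNReal.add_ne_top.2 ⟨hF, hF⟩))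
    (sInf_le fun x y => ?_)
  have hsum : ∀ x : Γ, ∑' z : Γ, ENNReal.ofReal (powerLaw α (dist x z)) ≤ fSum Γ (powerLaw α) :=
    le_iSup fun x : Γ => ∑' z : Γ, ENNReal.ofReal (powerLaw α (dist x z))
  have hpos : ∀ x y : Γ, 0 ≤ powerLaw α (dist x y) := fun x y => (powerLaw_pos α dist_nonneg).le
  calc ∑' z : Γ, ENNReal.ofReal (powerLaw α (dist x z)) * ENNReal.ofReal (powerLaw α (dist z y))
      ≤ ∑' z : Γ, ENNReal.ofReal (2 ^ α * powerLaw α (dist x y)) *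
          (ENNReal.ofReal (powerLaw α (dist x z)) + ENNReal.ofReal (powerLaw α (dist y z))) := by
        refine ENNReal.tsum_le_tsum fun z => ?_
        rw [← ENNReal.ofReal_mul (hpos _ _), ← ENNReal.ofReal_add (hpos _ _) (hpos _ _),
          ← ENNReal.ofReal_mul (mul_nonneg (by positivity) (hpos _ _)), dist_comm y z]
        exact ENNReal.ofReal_le_ofReal (powerLaw_mul_powerLaw_le hα dist_nonneg dist_nonneg
          dist_nonneg (dist_triangle x z y))
    _ ≤ ENNReal.ofReal (2 ^ α * powerLaw α (dist x y)) *
          (fSum Γ (powerLaw α) + fSum Γ (powerLaw α)) := by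
        rw [ENNReal.tsum_mul_left, ENNReal.tsum_add]
        gcongr <;> exact hsum _
    _ = ENNReal.ofReal (2 ^ α) * (fSum Γ (powerLaw α) + fSum Γ (powerLaw α)) *
          ENNReal.ofReal (powerLaw α (dist x y)) := by
        rw [ENNReal.ofReal_mul (by positivity)]
        ring

theorem isFFunction_powerLaw (hα : 0 ≤ α) (hF : fSum Γ (powerLaw α) ≠ ∞) :
    IsFFunction Γ (powerLaw α) where
  pos _ := powerLaw_pos α
  antitone _ hr _ _ := powerLaw_le_powerLaw hα hr
  summable := hF
  convolution := convConst_powerLaw_ne_top hα hF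

end PowerLaw

namespace IsRegular

open Finset

variable {Γ : Type*} [MetricSpace Γ] {κ ν α β δ ε r s : ℝ}

theorem card_le (hreg : IsRegular Γ κ ν) (x : Γ) (n : ℕ) {T : Finset Γ}
    (hT : ∀ y ∈ T, dist y x ≤ (n : ℝ) + 1) : (T.card : ℝ) ≤ κ * ((n : ℝ) + 1) ^ ν := by
  refine le_trans ?_ (hreg x n).2
  rw [← Set.ncard_coe_finset]
  exact_mod_cast Set.ncard_le_ncard (fun y hy => Metric.mem_closedBall.2 (hT y hy)) (hreg x n).1

theorem one_le_mul_rpow [Nonempty Γ] (hreg : IsRegular Γ κ ν) (n : ℕ) :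
    1 ≤ κ * ((n : ℝ) + 1) ^ ν := by
  obtain ⟨x⟩ := ‹Nonempty Γ›
  simpa using hreg.card_le x n (T := {x}) fun y hy => by
    rw [mem_singleton.1 hy, dist_self]
    positivity

theorem const_pos [Nonempty Γ] (hreg : IsRegular Γ κ ν) : 0 < κ :=
  zero_lt_one.trans_le (by simpa using hreg.one_le_mul_rpow 0)

theorem exponent_nonneg [Nonempty Γ] (hreg : IsRegular Γ κ ν) : 0 ≤ ν := by
  by_contra! hν
  have hlim : Filter.Tendsto (fun n : ℕ => κ * ((n : ℝ) + 1) ^ ν) Filter.atTop (nhds (κ * 0)) := by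
    have h := (tendsto_rpow_neg_atTop (neg_pos.2 hν)).comp
      (Filter.tendsto_atTop_add_const_right _ 1 tendsto_natCast_atTop_atTop)
    rw [neg_neg] at h
    exact h.const_mul κ
  have h := ge_of_tendsto' hlim hreg.one_le_mul_rpow
  norm_num at h

theorem sum_powerLaw_le (hreg : IsRegular Γ κ ν) (hε : 0 < ε) (x : Γ) (T : Finset Γ) :
    ∑ y ∈ T, powerLaw (ν + (1 + ε)) (dist y x) ≤ κ * zetaConst ε := by
  classical
  have : Nonempty Γ := ⟨x⟩
  have hκ := hreg.const_pos
  have hν := hreg.exponent_nonneg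
  have hshell : ∀ n : ℕ, ∑ y ∈ T with ⌊dist y x⌋₊ = n, powerLaw (ν + (1 + ε)) (dist y x) ≤
      κ * (1 / (1 + (n : ℝ)) ^ (1 + ε)) := fun n => by
    have hcard : (#{y ∈ T | ⌊dist y x⌋₊ = n} : ℝ) ≤ κ * ((n : ℝ) + 1) ^ ν :=
      hreg.card_le x n fun y hy => by
        rw [← (mem_filter.1 hy).2]
        exact (Nat.lt_floor_add_one _).le
    calc _ ≤ ∑ y ∈ T with ⌊dist y x⌋₊ = n, powerLaw (ν + (1 + ε)) n := by
          refine sum_le_sum fun y hy => powerLaw_le_powerLaw (by linarith) (by positivity) ?_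
          rw [← (mem_filter.1 hy).2]
          exact Nat.floor_le dist_nonneg
      _ = #{y ∈ T | ⌊dist y x⌋₊ = n} * powerLaw (ν + (1 + ε)) n := by
          rw [sum_const, nsmul_eq_mul]
      _ ≤ κ * ((n : ℝ) + 1) ^ ν * powerLaw (ν + (1 + ε)) n :=
          mul_le_mul_of_nonneg_right hcard (powerLaw_pos _ (by positivity)).le
      _ = κ * (1 / (1 + (n : ℝ)) ^ (1 + ε)) := by
          rw [powerLaw_add _ _ (by positivity), powerLaw, powerLaw, add_comm (n : ℝ) 1]
          field_simp
  rw [← sum_fiberwise_of_maps_to fun y hy => mem_image_of_mem (fun y => ⌊dist y x⌋₊) hy]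
  refine (sum_le_sum fun n _ => hshell n).trans ?_
  rw [← mul_sum]
  exact mul_le_mul_of_nonneg_left
    ((summable_one_div_one_add_rpow hε).sum_le_tsum _ fun n _ => by positivity) hκ.le

theorem isTailBound_powerLaw (hreg : IsRegular Γ κ ν) (hε : 0 < ε) (hα : ν + 1 + ε ≤ α)
    (hs : 0 ≤ s) :
    IsTailBound Γ (powerLaw α) s (κ * zetaConst ε * powerLaw (α - ν - 1 - ε) s) := by
  intro x T hT
  have hsplit : ∀ y ∈ T, powerLaw α (dist y x) ≤
      powerLaw (ν + (1 + ε)) (dist y x) * powerLaw (α - ν - 1 - ε) s := fun y hy => by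
    rw [show α = ν + (1 + ε) + (α - ν - 1 - ε) by ring, powerLaw_add _ _ dist_nonneg,
      show ν + (1 + ε) + (α - ν - 1 - ε) - ν - 1 - ε = α - ν - 1 - ε by ring]
    exact mul_le_mul_of_nonneg_left (powerLaw_le_powerLaw (by linarith) hs (hT y hy))
      (powerLaw_pos _ dist_nonneg).le
  refine (sum_le_sum hsplit).trans ?_
  rw [← sum_mul]
  exact mul_le_mul_of_nonneg_right (hreg.sum_powerLaw_le hε x T) (powerLaw_pos _ hs).le

theorem isFFunction_powerLaw [Nonempty Γ] (hreg : IsRegular Γ κ ν) (hα : ν + 1 < α) :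
    IsFFunction Γ (powerLaw α) :=
  OpenSpin.isFFunction_powerLaw (by linarith [hreg.exponent_nonneg])
    ((hreg.isTailBound_powerLaw (sub_pos.2 hα) (by linarith) le_rfl).fSum_ne_top
      fun _ hr => (powerLaw_pos α hr).le)

theorem card_inflationIn_le (hreg : IsRegular Γ κ ν) (hr : 0 ≤ r) (Λ X : Finset Γ) :
    (#(inflationIn Λ X r) : ℝ) ≤ #X * (κ * (1 + r) ^ ν) := by
  classical
  have hsub : inflationIn Λ X r ⊆ X.biUnion fun x => {y ∈ Λ | dist y x ≤ r} := fun y hy => by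
    obtain ⟨hyΛ, x, hx, hxy⟩ := mem_inflationIn.1 hy
    exact mem_biUnion.2 ⟨x, hx, mem_filter.2 ⟨hyΛ, hxy⟩⟩
  have hball : ∀ x : Γ, (#{y ∈ Λ | dist y x ≤ r} : ℝ) ≤ κ * (1 + r) ^ ν := fun x => by
    have : Nonempty Γ := ⟨x⟩
    have hκ := hreg.const_pos
    have hν := hreg.exponent_nonneg
    calc (#{y ∈ Λ | dist y x ≤ r} : ℝ) ≤ κ * ((⌊r⌋₊ : ℝ) + 1) ^ ν :=
          hreg.card_le x _ fun y hy => (mem_filter.1 hy).2.trans (Nat.lt_floor_add_one r).le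
      _ ≤ κ * (1 + r) ^ ν := by
          rw [add_comm 1 r]
          gcongr
          exact Nat.floor_le hr
  calc (#(inflationIn Λ X r) : ℝ) ≤ ∑ x ∈ X, (#{y ∈ Λ | dist y x ≤ r} : ℝ) := by
        exact_mod_cast (card_le_card hsub).trans card_biUnion_le
    _ ≤ ∑ _x ∈ X, κ * (1 + r) ^ ν := sum_le_sum fun x _ => hball x
    _ = #X * (κ * (1 + r) ^ ν) := by rw [sum_const, nsmul_eq_mul]

theorem card_inflationIn_mul_add_le [Nonempty Γ] (hreg : IsRegular Γ κ ν) (hβ : 0 ≤ β)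
    (hδ : 0 ≤ δ) (hδ' : δ ≤ 1) (hr : 0 ≤ r) (Λ X : Finset Γ) :
    #(inflationIn Λ X r) * powerLaw β (r ^ (1 - δ) / 2) + #X * powerLaw β r * Real.exp 1 ≤
      #X * (κ * 2 ^ β + Real.exp 1) / (1 + r) ^ ((1 - δ) * β - ν) := by
  have hκ := hreg.const_pos
  have hν := hreg.exponent_nonneg
  have hfar : powerLaw β r ≤ 1 / (1 + r) ^ ((1 - δ) * β - ν) := by
    unfold powerLaw
    gcongr
    · linarith
    · nlinarith
  calc #(inflationIn Λ X r) * powerLaw β (r ^ (1 - δ) / 2) + #X * powerLaw β r * Real.exp 1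
      ≤ #X * (κ * (1 + r) ^ ν) * (2 ^ β / (1 + r) ^ ((1 - δ) * β)) +
          #X * (1 / (1 + r) ^ ((1 - δ) * β - ν)) * Real.exp 1 := by
        have := (powerLaw_pos β (r := r ^ (1 - δ) / 2) (by positivity)).le
        gcongr
        · exact hreg.card_inflationIn_le hr Λ X
        · exact powerLaw_half_rpow_le hβ hδ hδ' hr
    _ = #X * (κ * 2 ^ β + Real.exp 1) / (1 + r) ^ ((1 - δ) * β - ν) := by
        rw [Real.rpow_sub (by positivity)]
        field_simp

theorem le_localizationConst [Nonempty Γ] (hreg : IsRegular Γ κ ν) (hε : 0 < ε)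
    (hα : ν + 1 + ε ≤ α) (hδ : δ ≤ 1) :
    κ * zetaConst ε * (κ * 2 ^ (α - ν - 1 - ε) + Real.exp 1) ≤
      localizationConst Γ κ ν α ε δ := by
  have hκ := hreg.const_pos
  have hz := zetaConst_pos hε
  have hC := (hreg.isFFunction_powerLaw (by linarith : ν + 1 < α)).convConst_pos
  have hβ : 0 ≤ α - ν - 1 - ε := by linarith
  unfold localizationConst
  set C := (convConst Γ (powerLaw α)).toReal
  set β := α - ν - 1 - ε
  have hpow : (2 : ℝ) ^ β ≤ 2 ^ (2 * β) * 2 ^ (1 - δ) := by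
    rw [← Real.rpow_add two_pos]
    exact Real.rpow_le_rpow_of_exponent_le one_le_two (by linarith)
  calc κ * zetaConst ε * (κ * 2 ^ β + Real.exp 1)
      = κ * zetaConst ε / C * (κ * 2 ^ β * C + Real.exp 1 * C) := by field_simp
    _ ≤ κ * zetaConst ε / C * (κ * (2 ^ (2 * β) * 2 ^ (1 - δ)) * (zetaConst ε + C) +
          Real.exp 1 * (C + (fSum Γ (powerLaw α)).toReal)) := by
        gcongr
        · exact le_add_of_nonneg_left hz.le
        · exact le_add_of_nonneg_right ENNReal.toReal_nonneg
    _ = _ := by rw [← mul_assoc κ]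

end IsRegular

end OpenSpin

theorem theorem2p9_general {Γ : Type*} [MetricSpace Γ] [Nonempty Γ] [DecidableEq Γ]
    (ι : Γ → Type*) [∀ x, Fintype (ι x)] [∀ x, DecidableEq (ι x)]
    (κ ν : ℝ) (hreg : OpenSpin.IsRegular Γ κ ν) (α ε : ℝ) (hε : 0 < ε) (hα : ν + 1 + ε ≤ α)
    (L : OpenSpin.Interaction ι) (hL : L.fNorm (OpenSpin.powerLaw α) ≠ ⊤)
    (δ : ℝ) (hδ : 0 ≤ δ) (hδ' : δ ≤ 1) :
    OpenSpin.IsFFunction Γ (OpenSpin.powerLaw α) ∧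
    0 < OpenSpin.localizationConst Γ κ ν α ε δ ∧
    ∀ (X Λ : Finset Γ) (hX : X ⊆ Λ) (A : OpenSpin.Obs ι X) (r t : ℝ) (hr : 0 ≤ r),
      0 ≤ t →
      Real.exp 1 * ((L.fNorm (OpenSpin.powerLaw α)).toReal *
        (OpenSpin.convConst Γ (OpenSpin.powerLaw α)).toReal) * t ≤ r ^ δ →
      ‖L.dynamics Λ t (OpenSpin.embed hX A) -
          OpenSpin.embed (OpenSpin.inflationIn_subset Λ X r)
            (L.dynamics (OpenSpin.inflationIn Λ X r) t
              (OpenSpin.embed (OpenSpin.subset_inflationIn hX hr) A))‖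
        ≤ OpenSpin.localizationConst Γ κ ν α ε δ * ‖A‖ * (X.card : ℝ) *
            (L.fNorm (OpenSpin.powerLaw α)).toReal *
            (t / (1 + r) ^ ((1 - δ) * (α - ν - 1 - ε) - ν)) := by
  have hF := hreg.isFFunction_powerLaw (by linarith : ν + 1 < α)
  have hκ := hreg.const_pos
  have hz := OpenSpin.zetaConst_pos hε
  have hconst := hreg.le_localizationConst hε hα hδ'
  refine ⟨hF, lt_of_lt_of_le (by positivity) hconst, fun X Λ hX A r t hr ht htr => ?_⟩
  have hscale : r ^ δ * r ^ (1 - δ) = r := by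
    rw [← Real.rpow_add_of_nonneg hr hδ (by linarith), add_sub_cancel, Real.rpow_one]
  have hloc := L.norm_dynamics_sub_le hF hL (by positivity) hr hscale.le
    (hreg.isTailBound_powerLaw hε hα (by positivity)) (hreg.isTailBound_powerLaw hε hα hr) hX A ht
    (by rwa [← mul_assoc])
  have hsize := hreg.card_inflationIn_mul_add_le (by linarith : 0 ≤ α - ν - 1 - ε) hδ hδ' hr Λ X
  set N := (L.fNorm (OpenSpin.powerLaw α)).toReal
  set K := κ * OpenSpin.zetaConst ε
  set q := (1 + r) ^ ((1 - δ) * (α - ν - 1 - ε) - ν)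
  calc _ ≤ _ := hloc
    _ = ‖A‖ * N * t * K * _ := by ring
    _ ≤ _ := mul_le_mul_of_nonneg_left hsize (by positivity)
    _ = K * (κ * 2 ^ (α - ν - 1 - ε) + Real.exp 1) * ‖A‖ * X.card * N * (t / q) := by ring
    _ ≤ _ := by gcongr

theorem theorem2p9 {Γ : Type*} [MetricSpace Γ] [Countable Γ] [Nonempty Γ] [DecidableEq Γ]
    (ι : Γ → Type*) [∀ x, Fintype (ι x)] [∀ x, DecidableEq (ι x)]
    (κ ν : ℝ) (hκ : 0 < κ) (hν : 0 < ν) (hreg : OpenSpin.IsRegular Γ κ ν)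
    (α : ℝ) (hα : 2 * ν + 1 < α)
    (L : OpenSpin.Interaction ι) (hL : L.fNorm (OpenSpin.powerLaw α) ≠ ⊤)
    (ε : ℝ) (hε : 0 < ε) (hε' : ε < α - 2 * ν - 1)
    (δ : ℝ) (hδ : 0 < δ) (hδ' : δ < 1) (hδν : ν < (1 - δ) * (α - ν - 1 - ε)) :
    OpenSpin.IsFFunction Γ (OpenSpin.powerLaw α) ∧
    0 < OpenSpin.localizationConst Γ κ ν α ε δ ∧
    ∀ (X Λ : Finset Γ) (hX : X ⊆ Λ) (A : OpenSpin.Obs ι X) (r t : ℝ) (hr : 1 ≤ r),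
      0 ≤ t →
      Real.exp 1 * ((L.fNorm (OpenSpin.powerLaw α)).toReal *
        (OpenSpin.convConst Γ (OpenSpin.powerLaw α)).toReal) * t ≤ r ^ δ →
      ‖L.dynamics Λ t (OpenSpin.embed hX A) -
          OpenSpin.embed (OpenSpin.inflationIn_subset Λ X r)
            (L.dynamics (OpenSpin.inflationIn Λ X r) t
              (OpenSpin.embed (OpenSpin.subset_inflationIn hX (zero_le_one.trans hr)) A))‖
        ≤ OpenSpin.localizationConst Γ κ ν α ε δ * ‖A‖ * (X.card : ℝ) *
            (L.fNorm (OpenSpin.powerLaw α)).toReal *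
            (t / (1 + r) ^ ((1 - δ) * (α - ν - 1 - ε) - ν)) := by
  obtain ⟨hF, hC, hbound⟩ :=
    theorem2p9_general ι κ ν hreg α ε hε (by linarith) L hL δ hδ.le hδ'.le
  exact ⟨hF, hC, fun X Λ hX A r t hr => hbound X Λ hX A r t (zero_le_one.trans hr)⟩
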